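/- For a congruence subgroup $\Gamma\subset SL(2,\mathbb Z)$ let $\mathcal R_\Gamma=\bigoplus_k \mathcal M_k(\Gamma)$ be the graded ring of modular forms on $\Gamma$, and let $\mathcal R=\mathcal R_{SL(2,\mathbb Z)}$. With $q=e^{2\pi i\tau}$, put $$a=-\tfrac13\Bigl(1+240\sum_{n\ge1}\sigma_3(n)q^n\Bigr)\in\mathcal M_4(SL(2,\mathbb Z)),\qquad b=\tfrac2{27}\Bigl(1-504\sum_{n\ge1}\sigma_5(n)q^n\Bigr)\in\mathcal M_6(SL(2,\mathbb Z)),$$ $$e=-\tfrac23\Bigl(1+24\sum_{n\ge1}\Bigl(\sum_{d\mid n,\ d\text{ odd}}d\Bigr)q^n\Bigr)\in\mathcal M_2(\Gamma_0(2)).$$ For $f\in\mathcal M_k(SL(2,\mathbb Z))$ put $f'(\tau)=2^kf(2\tau)$, which lies in $\mathcal M_k(\Gamma_0(2))$, and $$T_2f(\tau)=\tfrac12\Bigl(2^kf(2\tau)+f\bigl(\tfrac{\tau}{2}\bigr)+f\bigl(\tfrac{\tau+1}{2}\bigr)\Bigr);$$ extend both maps additively to $\mathcal R\to\mathcal R_{\Gamma_0(2)}$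 and $T_2:\mathcal R\to\mathcal R$. Let $$F_2(a,b,A,B)=\sum_{i,j\ge0}A^iB^j\,T_2(a^ib^j)\in\mathcal R[[A,B]],$$ with formal variables $A,B$. **Theorem 3.4.** (i) $\mathcal R=\mathbb C[a,b]$, with $a,b$ algebraically independent over $\mathbb C$. (ii) $\mathcal R_{\Gamma_0(2)}$ is a free $\mathcal R$-module with basis $1,e,e^2$. Let $\rho:\mathcal R_{\Gamma_0(2)}\to M_{3\times3}(\mathcal R)$ be the regular representation in this basis, so that $$\rho(e)=\begin{pmatrix}0&0&-b\\1&0&-a\\0&1&0\end{pmatrix}.$$ Then $(I-A\rho(a'))(I-B\rho(b'))$ is invertible over $\mathcal R[[A,B]]$ and $$F_2=\tfrac12\operatorname{tr}\bigl[(I-A\rho(a'))(I-B\rho(b'))\bigr]^{-1}.$$ (iii) Let $$M=\begin{pmatrix}1+4Aa&-15Ab&0\\0&1-11Aa&-15Ab\\15A&0&1-11Aa\end{pmatrix}\begin{pmatrix}1-22Bb&0&14Bab\\-14Ba&1-22Bb&14Ba^2\\0&-14Ba&1-22Bb\end{pmatrix}.$$ Then $M$ is invertible over $\mathcal R[[A,B]]$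 and $F_2=\tfrac12\operatorname{tr}M^{-1}$. (iv) In particular $F_2\in\mathbb Q(a,b,A,B)$, where $a,b,A,B$ are algebraically independent over $\mathbb Q$, and its denominator is $\det M$: there is a polynomial $P\in\mathbb Q[a,b,A,B]$ that has no non-unit common factor with $\det M$ in $\mathbb Q[a,b,A,B]$ and satisfies $F_2\cdot\det M=P$. -/

import Mathlib

open scoped DirectSum MatrixGroups ModularForm Manifold Pointwise

namespace HeckeGen

open UpperHalfPlane CongruenceSubgroup Matrix.SpecialLinearGroup

/-- The group `Γ₀(2)`, viewed inside `GL(2, ℝ)`. -/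
abbrev G02 : Subgroup (GL (Fin 2) ℝ) := (Gamma0 2).map (mapGL ℝ)

/-- The graded ring of modular forms of full level. (The weights run over `ℤ`; there are no
nonzero modular forms of negative weight.) -/
abbrev R1 : Type := ⨁ k : ℤ, ModularForm 𝒮ℒ k

/-- The graded ring of modular forms on `Γ₀(2)`. -/
abbrev R2 : Type := ⨁ k : ℤ, ModularForm G02 k

/-! ### Slash action of upper triangular matrices -/

/-- The matrix with rows `(x, y)` and `(0, z)`. -/
noncomputable def ups (x y z : ℝ) (h : x * z ≠ 0) : GL (Fin 2) ℝ :=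
  Matrix.GeneralLinearGroup.mkOfDetNeZero !![x, y; 0, z] (by simpa [Matrix.det_fin_two] using h)

lemma ups_slash (x y z : ℝ) (h : 0 < x * z) (f : ℍ → ℂ) (k : ℤ) (τ τ' : ℍ)
    (hτ : (τ' : ℂ) = (x * τ + y) / z) :
    (f ∣[k] ups x y z h.ne') τ = f τ' * ((x * z : ℝ) : ℂ) ^ (k - 1) * (z : ℂ) ^ (-k) := by
  have hd : (Matrix.GeneralLinearGroup.det (ups x y z h.ne')).val = x * z := by
    simp [ups, Matrix.GeneralLinearGroup.mkOfDetNeZero, Matrix.det_fin_two]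
  have hpos : 0 < (Matrix.GeneralLinearGroup.det (ups x y z h.ne')).val := by rw [hd]; exact h
  have hp : ups x y z h.ne' • τ = τ' := by
    apply UpperHalfPlane.ext
    rw [coe_smul_of_det_pos hpos, hτ]
    simp [num, denom, ups, Matrix.GeneralLinearGroup.mkOfDetNeZero]
  rw [ModularForm.slash_apply, hp, hd, abs_of_pos h]
  simp only [σ, hpos, if_true, ContinuousAlgEquiv.refl_apply]
  simp [denom, ups, Matrix.GeneralLinearGroup.mkOfDetNeZero]

/-- The point `2τ` of the upper half plane. -/
noncomputable def dbl (τ : ℍ) : ℍ := ⟨2 * (τ : ℂ), by simpa using τ.im_pos⟩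

/-- The point `(τ + t) / 2` of the upper half plane. -/
noncomputable def halve (t : ℕ) (τ : ℍ) : ℍ :=
  ⟨((τ : ℂ) + t) / 2, by
    have := τ.im_pos
    simpa using this⟩

noncomputable def gD : GL (Fin 2) ℝ := ups 2 0 1 (by norm_num)

noncomputable def gH (t : ℕ) : GL (Fin 2) ℝ := ups 1 t 2 (by norm_num)

lemma slash_gD (f : ℍ → ℂ) (k : ℤ) (τ : ℍ) :
    (f ∣[k] gD) τ = (2 : ℂ) ^ (k - 1) * f (dbl τ) := by
  rw [gD, ups_slash 2 0 1 (by norm_num) f k τ (dbl τ) (by simp [dbl])]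
  simp [mul_comm]

lemma slash_gH (t : ℕ) (f : ℍ → ℂ) (k : ℤ) (τ : ℍ) :
    (f ∣[k] gH t) τ = (1 / 2 : ℂ) * f (halve t τ) := by
  rw [gH, ups_slash 1 t 2 (by norm_num) f k τ (halve t τ) (by simp [halve])]
  have : ((2 : ℂ)) ^ (k - 1) * (2 : ℂ) ^ (-k) = 1 / 2 := by
    rw [← zpow_add₀ two_ne_zero, show k - 1 + -k = (-1 : ℤ) by ring]; norm_num
  push_cast
  rw [one_mul, mul_assoc, this, mul_comm]

lemma ups_mul {x y z x' y' z' : ℝ} {h : x * z ≠ 0} {h' : x' * z' ≠ 0} (γ δ : SL(2, ℤ))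
    (h00 : x * γ 0 0 + y * γ 1 0 = δ 0 0 * x')
    (h01 : x * γ 0 1 + y * γ 1 1 = δ 0 0 * y' + δ 0 1 * z')
    (h10 : z * γ 1 0 = δ 1 0 * x') (h11 : z * γ 1 1 = δ 1 0 * y' + δ 1 1 * z') :
    ups x y z h * mapGL ℝ γ = mapGL ℝ δ * ups x' y' z' h' := by
  have e : ∀ (γ : SL(2, ℤ)) (i j : Fin 2),
      (mapGL ℝ γ : Matrix (Fin 2) (Fin 2) ℝ) i j = ((γ i j : ℤ) : ℝ) := fun _ _ _ => rfl
  ext i j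
  rw [Units.val_mul, Units.val_mul, Matrix.mul_apply, Matrix.mul_apply, Fin.sum_univ_two,
    Fin.sum_univ_two, e, e, e, e]
  fin_cases i <;> fin_cases j <;>
    simp [ups, Matrix.GeneralLinearGroup.mkOfDetNeZero, h00, h01, h10, h11]

lemma gD_mul (γ : SL(2, ℤ)) (hγ : γ ∈ Gamma0 2) :
    ∃ δ : SL(2, ℤ), gD * mapGL ℝ γ = mapGL ℝ δ * gD ∧ γ 1 0 = 2 * δ 1 0 ∧ δ 1 1 = γ 1 1 := by
  rw [Gamma0_mem, ZMod.intCast_zmod_eq_zero_iff_dvd] at hγ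
  obtain ⟨c, hc⟩ := hγ
  have hdet := γ.det_coe
  rw [Matrix.det_fin_two] at hdet
  push_cast at hc
  have hc' : ((γ 1 0 : ℤ) : ℝ) = 2 * c := by rw [hc]; push_cast; ring
  refine ⟨⟨!![γ 0 0, 2 * γ 0 1; c, γ 1 1], ?_⟩, ?_, ?_, rfl⟩
  · rw [Matrix.det_fin_two_of]
    rw [hc] at hdet
    linarith
  · apply ups_mul <;> simp [hc', mul_comm]
  · simpa using hc

lemma G02_le : G02 ≤ ConjAct.toConjAct gD⁻¹ • 𝒮ℒ := by
  rintro _ ⟨γ, hγ, rfl⟩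
  obtain ⟨δ, hδ, -⟩ := gD_mul γ hγ
  rw [Subgroup.mem_pointwise_smul_iff_inv_smul_mem]
  refine ⟨δ, ?_⟩
  simp only [ConjAct.toConjAct_inv, inv_inv, ConjAct.smul_def, ConjAct.ofConjAct_toConjAct]
  rw [hδ, mul_inv_cancel_right]

lemma G02_le_SL : G02 ≤ 𝒮ℒ := by
  rintro _ ⟨γ, -, rfl⟩
  exact ⟨γ, rfl⟩

/-! ### The inclusion of rings and the map `f ↦ f'` -/

/-- A modular form of full level is a modular form on `Γ₀(2)`. -/
noncomputable def resForm {k : ℤ} (f : ModularForm 𝒮ℒ k) : ModularForm G02 k where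
  toFun := f
  slash_action_eq' γ hγ := f.slash_action_eq' γ (G02_le_SL hγ)
  holo' := f.holo'
  bdd_at_cusps' hc := f.bdd_at_cusps' (hc.mono G02_le_SL)

/-- The inclusion of the ring of forms of full level into the ring of forms on `Γ₀(2)`. -/
noncomputable def incl : R1 →ₐ[ℂ] R2 :=
  DirectSum.toAlgebra ℂ (ModularForm 𝒮ℒ)
    (fun k =>
      (DirectSum.lof ℂ ℤ (ModularForm G02) k).comp
        ({ toFun := resForm, map_add' := fun _ _ => rfl, map_smul' := fun _ _ => rfl } :
          ModularForm 𝒮ℒ k →ₗ[ℂ] ModularForm G02 k))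
    rfl
    (fun {i j} f g => by
      simp only [LinearMap.comp_apply, DirectSum.lof_eq_of, DirectSum.of_mul_of]
      rfl)

/-- The ring of forms on `Γ₀(2)` is an algebra over the ring of forms of full level. -/
noncomputable instance : Algebra R1 R2 := incl.toRingHom.toAlgebra

lemma primeFun_eq (k : ℤ) (f : ℍ → ℂ) :
    (fun τ => (2 : ℂ) ^ k * f (dbl τ)) = (2 : ℂ) • (f ∣[k] gD) := by
  ext τ
  rw [Pi.smul_apply, slash_gD, smul_eq_mul, ← mul_assoc, ← zpow_one_add₀ two_ne_zero]
  simp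

/-- For `f` of weight `k` and full level, `f'(τ) = 2 ^ k f(2τ)`, a form on `Γ₀(2)`. -/
noncomputable def primeForm {k : ℤ} (f : ModularForm 𝒮ℒ k) : ModularForm G02 k where
  toFun τ := (2 : ℂ) ^ k * f (dbl τ)
  slash_action_eq' γ hγ := by
    rw [primeFun_eq]
    exact ((2 : ℂ) • ModularForm.translate f gD).slash_action_eq' γ (G02_le hγ)
  holo' := by
    simp only [SlashInvariantForm.coe_mk]
    rw [primeFun_eq]
    exact ((2 : ℂ) • ModularForm.translate f gD).holo'
  bdd_at_cusps' hc := by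
    rw [primeFun_eq]
    exact ((2 : ℂ) • ModularForm.translate f gD).bdd_at_cusps' (hc.mono G02_le)

/-- The linear map `f ↦ f'` in weight `k`. -/
noncomputable def primeLin (k : ℤ) : ModularForm 𝒮ℒ k →ₗ[ℂ] ModularForm G02 k where
  toFun := primeForm
  map_add' f g := by
    ext τ
    change (2 : ℂ) ^ k * (f (dbl τ) + g (dbl τ)) =
      (2 : ℂ) ^ k * f (dbl τ) + (2 : ℂ) ^ k * g (dbl τ)
    ring
  map_smul' c f := by
    ext τ
    change (2 : ℂ) ^ k * (c * f (dbl τ)) = c * ((2 : ℂ) ^ k * f (dbl τ))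
    ring

/-- The map `f ↦ f'`, extended additively to the graded rings. -/
noncomputable def primeMap : R1 →ₗ[ℂ] R2 :=
  DirectSum.toModule ℂ ℤ R2 fun k =>
    (DirectSum.lof ℂ ℤ (ModularForm G02) k).comp (primeLin k)

/-! ### The Hecke operator `T₂` -/

/-- The function `T₂ f (τ) = (1/2) (2 ^ k f(2τ) + ∑_{t = 0, 1} f((τ + t)/2))`. -/
noncomputable def heckeFun (k : ℤ) (f : ℍ → ℂ) (τ : ℍ) : ℂ :=
  (1 / 2 : ℂ) * ((2 : ℂ) ^ k * f (dbl τ) + ∑ t ∈ Finset.range 2, f (halve t τ))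

lemma heckeFun_eq (k : ℤ) (f : ℍ → ℂ) :
    heckeFun k f = f ∣[k] gD + f ∣[k] gH 0 + f ∣[k] gH 1 := by
  ext τ
  simp only [Pi.add_apply, slash_gD, slash_gH, heckeFun, Finset.sum_range_succ,
    Finset.sum_range_zero]
  have : (2 : ℂ) ^ k = 2 * (2 : ℂ) ^ (k - 1) := by
    rw [← zpow_one_add₀ two_ne_zero]; simp
  rw [this]
  ring

lemma slash_mul_of_eq {f : ℍ → ℂ} {k : ℤ} (hf : ∀ γ : SL(2, ℤ), f ∣[k] (mapGL ℝ γ) = f)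
    (g h : GL (Fin 2) ℝ) (γ δ : SL(2, ℤ)) (e : g * mapGL ℝ γ = mapGL ℝ δ * h) :
    (f ∣[k] g) ∣[k] γ = f ∣[k] h := by
  change (f ∣[k] g) ∣[k] (mapGL ℝ γ) = f ∣[k] h
  rw [← SlashAction.slash_mul, e, SlashAction.slash_mul, hf]

lemma heckeFun_slash {k : ℤ} (f : ModularForm 𝒮ℒ k) (γ : SL(2, ℤ)) :
    heckeFun k f ∣[k] γ = heckeFun k f := by
  have hf : ∀ γ : SL(2, ℤ), (f : ℍ → ℂ) ∣[k] (mapGL ℝ γ) = f := fun γ =>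
    f.slash_action_eq' _ ⟨γ, rfl⟩
  refine SlashInvariantForm.slash_action_generators_SL2Z ?_ ?_ γ
  · rw [heckeFun_eq, SlashAction.add_slash, SlashAction.add_slash]
    rw [slash_mul_of_eq hf gD (gH 0) _ ModularGroup.S,
      slash_mul_of_eq hf (gH 0) gD _ ModularGroup.S,
      slash_mul_of_eq hf (gH 1) (gH 1) _ ⟨!![1, -1; 2, -1], by simp [Matrix.det_fin_two]⟩]
    · abel
    all_goals apply ups_mul <;> simp [ModularGroup.S] <;> try norm_num
  · rw [heckeFun_eq, SlashAction.add_slash, SlashAction.add_slash]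
    rw [slash_mul_of_eq hf gD gD _ ⟨!![1, 2; 0, 1], by simp [Matrix.det_fin_two]⟩,
      slash_mul_of_eq hf (gH 0) (gH 1) _ 1,
      slash_mul_of_eq hf (gH 1) (gH 0) _ ModularGroup.T]
    · abel
    all_goals apply ups_mul <;> simp [ModularGroup.T] <;> try norm_num

/-- `T₂ f` as a modular form of full level. -/
noncomputable def heckeForm {k : ℤ} (f : ModularForm 𝒮ℒ k) : ModularForm 𝒮ℒ k where
  toFun := heckeFun k f
  slash_action_eq' := by
    rintro _ ⟨γ, rfl⟩
    exact heckeFun_slash f γ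
  holo' := by
    simp only [SlashInvariantForm.coe_mk]
    rw [heckeFun_eq]
    exact ((f.holo'.slash k _).add (f.holo'.slash k _)).add (f.holo'.slash k _)
  bdd_at_cusps' hc := by
    rw [OnePoint.isBoundedAt_iff_forall_SL2Z hc]
    intro γ _
    rw [heckeFun_slash, heckeFun_eq]
    have hb : IsBoundedAtImInfty (f : ℍ → ℂ) := ModularFormClass.bdd_at_infty f
    have h0 : ∀ x y z h, (ups x y z h) 1 0 = 0 := fun x y z h => by
      simp [ups, Matrix.GeneralLinearGroup.mkOfDetNeZero]
    exact ((hb.slash k (h0 _ _ _ _)).add (hb.slash k (h0 _ _ _ _))).add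
      (hb.slash k (h0 _ _ _ _))

/-- The Hecke operator `T₂` in weight `k`. -/
noncomputable def heckeLin (k : ℤ) : ModularForm 𝒮ℒ k →ₗ[ℂ] ModularForm 𝒮ℒ k where
  toFun := heckeForm
  map_add' f g := by
    ext τ
    change heckeFun k (fun z => f z + g z) τ = heckeFun k f τ + heckeFun k g τ
    simp only [heckeFun, Finset.sum_add_distrib]
    ring
  map_smul' c f := by
    ext τ
    change heckeFun k (fun z => c * f z) τ = c * heckeFun k f τ
    simp only [heckeFun, ← Finset.mul_sum]
    ring

/-- The Hecke operator `T₂`, extended additively to the graded ring of forms of full level. -/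
noncomputable def T2 : R1 →ₗ[ℂ] R1 :=
  DirectSum.toModule ℂ ℤ R1 fun k =>
    (DirectSum.lof ℂ ℤ (ModularForm 𝒮ℒ) k).comp (heckeLin k)

/-! ### The weight two form `e` -/

/-- The function `e(τ) = -(2/3) (1 + 24 ∑_{n ≥ 1} (∑_{d ∣ n, d odd} d) q ^ n)`, where
`q = exp(2 π i τ)`. -/
noncomputable def eFun (τ : ℍ) : ℂ :=
  -(2 / 3 : ℂ) * (1 + 24 * ∑' n : ℕ+,
    ((∑ d ∈ (n : ℕ).divisors with Odd d, d : ℕ) : ℂ) *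
      Complex.exp (2 * Real.pi * Complex.I * τ) ^ (n : ℕ))

open EisensteinSeries

lemma sigma_odd (n : ℕ) (hn : n ≠ 0) :
    ArithmeticFunction.sigma 1 n = (∑ d ∈ n.divisors with Odd d, d) +
      if 2 ∣ n then 2 * ArithmeticFunction.sigma 1 (n / 2) else 0 := by
  rw [ArithmeticFunction.sigma_one_apply, ← Finset.sum_filter_add_sum_filter_not _ (Odd ·)]
  congr 1
  split_ifs with h
  · obtain ⟨m, rfl⟩ := h
    rw [Nat.mul_div_cancel_left _ two_pos, ArithmeticFunction.sigma_one_apply, Finset.mul_sum]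
    symm
    refine Finset.sum_bij (fun d _ => 2 * d) ?_ ?_ ?_ ?_
    · intro d hd
      simp only [Nat.mem_divisors] at hd
      simp only [Finset.mem_filter, Nat.mem_divisors]
      exact ⟨⟨Nat.mul_dvd_mul_left 2 hd.1, hn⟩, by simp⟩
    · intro a _ b _ hab
      simpa using hab
    · intro b hb
      simp only [Finset.mem_filter, Nat.mem_divisors, Nat.not_odd_iff_even] at hb
      obtain ⟨c, hc⟩ := hb.2.two_dvd
      subst hc
      refine ⟨c, ?_, rfl⟩
      rw [Nat.mem_divisors]
      exact ⟨Nat.dvd_of_mul_dvd_mul_left two_pos hb.1.1, by aesop⟩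
    · intros; rfl
  · apply Finset.sum_eq_zero
    intro d hd
    simp only [Finset.mem_filter, Nat.mem_divisors, Nat.not_odd_iff_even] at hd
    exact absurd (hd.2.two_dvd.trans hd.1.1) h

lemma eFun_eq_E2 : eFun = (-(2 / 3) : ℂ) • (E2 ∣[(2 : ℤ)] gD - E2) := by
  ext τ
  have hS : ∀ z : ℍ, Summable fun n : ℕ+ => (ArithmeticFunction.sigma 1 (n : ℕ) : ℂ) *
      Complex.exp (2 * Real.pi * Complex.I * z) ^ (n : ℕ) := fun z =>
    (summable_sigma_mul_cexp_pow (k := 2) one_le_two z).comp_injective PNat.coe_injective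
  set q := Complex.exp (2 * Real.pi * Complex.I * τ) with hq
  have hq2 : Complex.exp (2 * Real.pi * Complex.I * (dbl τ : ℂ)) = q ^ 2 := by
    rw [hq, ← Complex.exp_nat_mul]
    congr 1
    simp only [dbl]
    push_cast
    ring
  let F : ℕ+ → ℂ := fun n => if 2 ∣ (n : ℕ) then
    2 * (ArithmeticFunction.sigma 1 ((n : ℕ) / 2) : ℂ) * q ^ (n : ℕ) else 0
  let i : ℕ+ → ℕ+ := fun n => 2 * n
  have hi : Function.Injective i := fun a b h => mul_left_cancel h
  have hF0 : ∀ x, x ∉ Set.range i → F x = 0 := by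
    intro x hx
    simp only [F]
    rw [if_neg]
    rintro h
    rw [show (2 : ℕ) = ((2 : ℕ+) : ℕ) from rfl, ← PNat.dvd_iff] at h
    obtain ⟨c, hc⟩ := h
    exact hx ⟨c, hc.symm⟩
  have hFi : F ∘ i = fun n : ℕ+ => 2 * ((ArithmeticFunction.sigma 1 (n : ℕ) : ℂ) *
      (q ^ 2) ^ (n : ℕ)) := by
    ext n
    simp only [F, i, Function.comp, PNat.mul_coe, PNat.val_ofNat, dvd_mul_right, if_true,
      Nat.mul_div_cancel_left _ two_pos, pow_mul]
    ring
  have hFs : HasSum F (2 * ∑' n : ℕ+, (ArithmeticFunction.sigma 1 (n : ℕ) : ℂ) *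
      (q ^ 2) ^ (n : ℕ)) := by
    rw [← hi.hasSum_iff hF0, hFi]
    have := (hS (dbl τ)).hasSum
    rw [hq2] at this
    exact this.mul_left 2
  have hodd : (fun n : ℕ+ => ((∑ d ∈ (n : ℕ).divisors with Odd d, d : ℕ) : ℂ) * q ^ (n : ℕ)) =
      fun n : ℕ+ => (ArithmeticFunction.sigma 1 (n : ℕ) : ℂ) * q ^ (n : ℕ) - F n := by
    ext n
    simp only [F]
    rw [sigma_odd n n.ne_zero]
    split_ifs <;> push_cast <;> ring
  have key := (hS τ).hasSum.sub hFs
  rw [← hq] at key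
  rw [Pi.smul_apply, Pi.sub_apply, slash_gD, E2_eq_tsum_cexp, E2_eq_tsum_cexp, hq2, ← hq, eFun,
    ← hq, hodd, key.tsum_eq]
  norm_num
  ring

lemma D2_slash (γ δ : SL(2, ℤ)) (h : γ 1 0 = 2 * δ 1 0) (h' : δ 1 1 = γ 1 1) :
    D2 δ ∣[(2 : ℤ)] gD = D2 γ := by
  ext τ
  rw [slash_gD]
  have hd : ((dbl τ : ℍ) : ℂ) = 2 * τ := rfl
  simp only [D2, ModularGroup.denom_apply, h, h']
  rw [hd]
  push_cast
  norm_num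
  ring_nf

lemma eFun_slash (γ : SL(2, ℤ)) (hγ : γ ∈ Gamma0 2) :
    eFun ∣[(2 : ℤ)] γ = eFun := by
  obtain ⟨δ, hδ, h1, h2⟩ := gD_mul γ hγ
  have e1 : (E2 ∣[(2 : ℤ)] gD) ∣[(2 : ℤ)] γ =
      E2 ∣[(2 : ℤ)] gD - (1 / (2 * riemannZeta 2)) • D2 γ := by
    change (E2 ∣[(2 : ℤ)] gD) ∣[(2 : ℤ)] (mapGL ℝ γ) = _
    rw [← SlashAction.slash_mul, hδ, SlashAction.slash_mul]
    change (E2 ∣[(2 : ℤ)] δ) ∣[(2 : ℤ)] gD = _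
    rw [E2_slash_action, ← D2_slash γ δ h1 h2]
    ext τ
    simp only [slash_gD, Pi.sub_apply, Pi.smul_apply, smul_eq_mul]
    ring
  rw [eFun_eq_E2, ModularForm.SL_smul_slash, sub_eq_add_neg, SlashAction.add_slash,
    SlashAction.neg_slash, e1, E2_slash_action]
  congr 1
  abel

lemma E2_bounded {c : OnePoint ℝ} (hc : IsCusp c 𝒮ℒ) : c.IsBoundedAt E2 2 := by
  rw [OnePoint.isBoundedAt_iff_forall_SL2Z hc]
  intro γ _
  rw [E2_slash_action, sub_eq_add_neg]
  refine isBoundedAtImInfty_E2.add ?_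
  have hD : IsBoundedAtImInfty (D2 γ) := by
    rw [isBoundedAtImInfty_iff]
    refine ⟨2 * Real.pi, 1, fun z hz => ?_⟩
    simp only [D2, ModularGroup.denom_apply]
    rw [norm_div]
    have hn : ‖(2 * Real.pi * Complex.I * (γ 1 0 : ℤ) : ℂ)‖ = 2 * Real.pi * |((γ 1 0 : ℤ) : ℝ)| := by
      simp [abs_of_pos Real.pi_pos]
    rw [hn]
    have him : |((γ 1 0 : ℤ) : ℝ)| ≤ ‖((γ 1 0 : ℤ) : ℂ) * z + (γ 1 1 : ℤ)‖ := by
      refine le_trans ?_ (Complex.abs_im_le_norm _)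
      simp only [Complex.add_im, Complex.mul_im, Complex.intCast_re, Complex.intCast_im, zero_mul,
        add_zero, coe_im, abs_mul]
      rw [abs_of_pos z.im_pos]
      exact le_mul_of_one_le_right (abs_nonneg _) hz
    exact div_le_of_le_mul₀ (norm_nonneg _) (by positivity)
      (mul_le_mul_of_nonneg_left him (by positivity))
  exact (hD.const_smul_left _).neg_left

/-- The form `e` of weight two on `Γ₀(2)`. -/
noncomputable def eForm : ModularForm G02 2 where
  toFun := eFun
  slash_action_eq' := by
    rintro _ ⟨γ, hγ, rfl⟩
    exact eFun_slash γ hγ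
  holo' := by
    simp only [SlashInvariantForm.coe_mk]
    rw [eFun_eq_E2]
    exact ((E2_mdifferentiable.slash 2 gD).sub E2_mdifferentiable).const_smul _
  bdd_at_cusps' {c} hc := by
    have h1 : c.IsBoundedAt (E2 ∣[(2 : ℤ)] gD) 2 := by
      rw [← OnePoint.IsBoundedAt.smul_iff]
      apply E2_bounded
      have := (hc.mono G02_le).smul gD
      simpa [smul_smul] using this
    have h2 : c.IsBoundedAt E2 2 := E2_bounded (hc.mono G02_le_SL)
    rw [eFun_eq_E2]
    intro g hg
    rw [ModularForm.smul_slash, sub_eq_add_neg, SlashAction.add_slash, SlashAction.neg_slash]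
    exact ((h1 g hg).add (h2 g hg).neg_left).const_smul_left _

/-! ### The generating function and the explicit matrix -/

/-- `a = -(1/3) E₄ = -(1/3) (1 + 240 ∑ σ₃(n) q ^ n)`, in the graded ring of full level. -/
noncomputable def a : R1 :=
  DirectSum.of (ModularForm 𝒮ℒ) 4 ((-(1 / 3) : ℂ) • ModularForm.E₄)

/-- `b = (2/27) E₆ = (2/27) (1 - 504 ∑ σ₅(n) q ^ n)`, in the graded ring of full level. -/
noncomputable def b : R1 :=
  DirectSum.of (ModularForm 𝒮ℒ) 6 ((2 / 27 : ℂ) • ModularForm.E₆)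

/-- The form `e`, in the graded ring of forms on `Γ₀(2)`. -/
noncomputable def e : R2 := DirectSum.of (ModularForm G02) 2 eForm

/-- Power series in two formal variables `A`, `B` over the graded ring of full level. -/
abbrev Ser : Type := MvPowerSeries (Fin 2) R1

/-- The formal variable `A`. -/
noncomputable def A : Ser := MvPowerSeries.X 0

/-- The formal variable `B`. -/
noncomputable def B : Ser := MvPowerSeries.X 1

/-- Elements of the graded ring as constant power series. -/
noncomputable def cst : R1 →+* Ser := MvPowerSeries.C

/-- The generating function `F₂ = ∑_{i, j ≥ 0} A ^ i B ^ j T₂(a ^ i b ^ j)`. -/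
noncomputable def F2 : Ser := fun n => T2 (a ^ n 0 * b ^ n 1)

/-- The explicit product of two `3 × 3` matrices, for elements `x, y, X, Y` of a commutative ring
in place of `a, b, A, B`. -/
def matM {K : Type*} [CommRing K] (x y X Y : K) : Matrix (Fin 3) (Fin 3) K :=
  !![1 + 4 * X * x, -15 * X * y, 0;
     0, 1 - 11 * X * x, -15 * X * y;
     15 * X, 0, 1 - 11 * X * x] *
  !![1 - 22 * Y * y, 0, 14 * Y * x * y;
     -14 * Y * x, 1 - 22 * Y * y, 14 * Y * x ^ 2;
     0, -14 * Y * x, 1 - 22 * Y * y]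

/-- The ring homomorphism from `ℚ[a, b, A, B]`, with `a, b, A, B` as indeterminates numbered
`0, 1, 2, 3`, to power series in `A`, `B` over the graded ring. -/
noncomputable def toSer : MvPolynomial (Fin 4) ℚ →+* Ser :=
  MvPolynomial.eval₂Hom ((algebraMap ℂ Ser).comp (algebraMap ℚ ℂ)) ![cst a, cst b, A, B]

/-- The determinant of the explicit matrix, as a polynomial in the four indeterminates. -/
noncomputable def detM : MvPolynomial (Fin 4) ℚ :=
  (matM (MvPolynomial.X 0) (MvPolynomial.X 1) (MvPolynomial.X 2) (MvPolynomial.X 3)).det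

end HeckeGen

/-!
`SL(2, ℤ)` has three cosets modulo `Γ₀(2)`, represented by `1`, `S` and `ST`, so
`f ↦ f + f ∣ S + f ∣ ST` maps forms on `Γ₀(2)` to forms of full level. This is an `R1`-linear
`trace : R2 → R1`, and the three conjugates of `f' = 2 ^ k f(2τ)` are `2 ^ k f(2τ)`, `f(τ/2)` and
`f((τ + 1)/2)`; hence `T₂ f = ½ trace f'` (`T2_eq_trace`). Since `f ↦ f'` is multiplicative, `F₂`
is half the trace of a product of two geometric series in the commuting elements `a'` and `b'`
of `R2`, and the theorem becomes a computation in the cubic extension `R2` of `R1`.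

Identities between elements of the graded rings are proved through ring homomorphisms to `ℂ`:
evaluation at a point (`evalAt`, which separates elements) and at a cusp (`cuspVal`). The
arithmetic input is that a form of full level vanishing at the cusp is divisible by `Δ`
(`Δg_dvd`), and so is zero in weight less than `12`. It gives `R1 = ℂ[a, b]`: modulo `Δ`, which is
a multiple of the discriminant `-4a³ - 27b²`, forms are determined by their values at the cusp.

By Newton's identities the conjugates of `e` are the roots of `x³ + ax + b`, whose discriminant is
`256 Δ`, without zeros in the upper half plane. So the trace form is nondegenerate and `1, e, e²`
are independent. They generate `R2` because the numerators in Cramer's rule vanish at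
the cusp, and so are divisible by the denominator `256 Δ` (`span_e`).
Nondegeneracy also shows that forms on `Γ₀(2)` of weight less than `8` are determined by their
values at the two cusps, whence `a' = -15e² - 4a` and `b' = 22b + 14ae`; this makes the two
factors of `M` the matrices of multiplication by `1 - Aa'` and `1 - Bb'`.

The numerator over `det M` is half the trace of the adjugate of `M`. The two factors of `det M`
involve only `a, b, A` and only `a, b, B`. A common divisor of the first factor and the numerator
does not involve `B`, so it divides the numerator at `B = 0`, a polynomial without `b`; hence it
does not involve `b` either, and comparing coefficients of powers of `b` in the first factor shows
that it is a unit. The second factor is treated alike, with `A` and `a` in place of `B` and `b`,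
except that `a` has to be eliminated from the second factor and the numerator at `A = 0` first.
-/

/-! ### Evaluation of graded modular forms at points and at cusps -/

namespace HeckeGen

open UpperHalfPlane CongruenceSubgroup Matrix.SpecialLinearGroup ModularForm Filter Topology

section Evaluation

variable {𝒢 : Subgroup (GL (Fin 2) ℝ)} [𝒢.HasDetOne]

/-- Evaluation of an element of the graded ring of modular forms at the point `γ • τ`: the
component `f` of weight `k` contributes `(f ∣[k] γ) τ * t ^ k`. The parameter `t` keeps the
weights apart; in terms of lattices, it is the scaling. -/
noncomputable def evalAt (γ : SL(2, ℤ)) (τ : ℍ) (t : ℂˣ) :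
    (⨁ k : ℤ, ModularForm 𝒢 k) →ₐ[ℂ] ℂ :=
  DirectSum.toAlgebra ℂ (ModularForm 𝒢)
    (fun k =>
      { toFun := fun f => ((f : ℍ → ℂ) ∣[k] γ) τ * (t : ℂ) ^ k
        map_add' := fun f g => by
          rw [FunLike.coe_add, SlashAction.add_slash, Pi.add_apply, add_mul]
        map_smul' := fun c f => by
          rw [FunLike.coe_smul, SL_smul_slash, Pi.smul_apply, smul_eq_mul, mul_assoc]
          rfl })
    (by
      change ((1 : ℍ → ℂ) ∣[(0 : ℤ)] γ) τ * (t : ℂ) ^ (0 : ℤ) = 1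
      rw [is_invariant_one]
      simp)
    (fun {i j} f g => by
      change ((f * g : ℍ → ℂ) ∣[i + j] γ) τ * (t : ℂ) ^ (i + j) =
        ((f : ℍ → ℂ) ∣[i] γ) τ * (t : ℂ) ^ i * (((g : ℍ → ℂ) ∣[j] γ) τ * (t : ℂ) ^ j)
      rw [mul_slash_SL2, Pi.mul_apply, zpow_add₀ t.ne_zero]
      ring)

lemma evalAt_of (γ : SL(2, ℤ)) (τ : ℍ) (t : ℂˣ) (k : ℤ) (f : ModularForm 𝒢 k) :
    evalAt γ τ t (DirectSum.of (ModularForm 𝒢) k f) =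
      ((f : ℍ → ℂ) ∣[k] γ) τ * (t : ℂ) ^ k := by
  rw [evalAt, DirectSum.toAlgebra_apply]
  exact DirectSum.toSemiring_of _ _ _ _ _

lemma evalAt_one_of (τ : ℍ) (t : ℂˣ) (k : ℤ) (f : ModularForm 𝒢 k) :
    evalAt 1 τ t (DirectSum.of (ModularForm 𝒢) k f) = f τ * (t : ℂ) ^ k := by
  rw [evalAt_of, SlashAction.slash_one]

/-- A Laurent polynomial that vanishes at every unit is zero. -/
lemma forall_eq_zero_of_sum_mul_zpow {s : Finset ℤ} {c : ℤ → ℂ}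
    (h : ∀ t : ℂˣ, ∑ k ∈ s, c k * (t : ℂ) ^ k = 0) : ∀ k ∈ s, c k = 0 := by
  obtain ⟨N, hN⟩ : ∃ N : ℕ, ∀ k ∈ s, 0 ≤ k + N := by
    refine ⟨∑ k ∈ s, k.natAbs, fun k hk => ?_⟩
    have : k.natAbs ≤ ∑ k ∈ s, k.natAbs :=
      Finset.single_le_sum (f := fun k : ℤ => k.natAbs) (fun _ _ => Nat.zero_le _) hk
    omega
  set p : Polynomial ℂ := ∑ k ∈ s, Polynomial.monomial (k + N).toNat (c k) with hp
  have hp0 : p = 0 := by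
    refine Polynomial.eq_zero_of_infinite_isRoot p
      (Set.Infinite.mono ?_ (Set.finite_singleton (0 : ℂ)).infinite_compl)
    intro x hx
    have hx0 : x ≠ 0 := by simpa using hx
    have := h (Units.mk0 x hx0)
    rw [Set.mem_ofPred_eq, Polynomial.IsRoot, hp, Polynomial.eval_finsetSum]
    rw [← mul_eq_zero_iff_left (pow_ne_zero N hx0), Finset.mul_sum] at this
    rw [← this]
    refine Finset.sum_congr rfl fun k hk => ?_
    rw [Polynomial.eval_monomial, Units.val_mk0, mul_left_comm, ← zpow_natCast x N,
      ← zpow_add₀ hx0, ← zpow_natCast, Int.toNat_of_nonneg (hN k hk), add_comm]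
  intro k hk
  have := congrArg (fun q => Polynomial.coeff q (k + N).toNat) hp0
  simp only [hp, Polynomial.finsetSum_coeff, Polynomial.coeff_monomial,
    Polynomial.coeff_zero] at this
  rw [Finset.sum_eq_single k] at this
  · simpa using this
  · intro j hj hjk
    rw [if_neg]
    have := hN j hj
    have := hN k hk
    omega
  · exact fun h => absurd hk h

lemma eq_zero_of_evalAt {x : ⨁ k : ℤ, ModularForm 𝒢 k} (h : ∀ τ t, evalAt 1 τ t x = 0) :
    x = 0 := by
  classical
  have hx : ∀ (τ : ℍ) (t : ℂˣ), ∑ k ∈ x.support, x k τ * (t : ℂ) ^ k = 0 := by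
    intro τ t
    rw [← h τ t]
    conv_rhs => rw [← DirectSum.sum_support_of x, map_sum]
    exact Finset.sum_congr rfl fun k _ => (evalAt_one_of τ t k _).symm
  refine DFinsupp.ext fun k => ?_
  by_cases hk : k ∈ x.support
  · ext τ
    exact forall_eq_zero_of_sum_mul_zpow (c := fun k => x k τ) (hx τ) k hk
  · exact DFinsupp.notMem_support_iff.mp hk

lemma ext_evalAt {x y : ⨁ k : ℤ, ModularForm 𝒢 k}
    (h : ∀ τ t, evalAt 1 τ t x = evalAt 1 τ t y) : x = y :=
  sub_eq_zero.mp <| eq_zero_of_evalAt fun τ t => by rw [map_sub, h, sub_self]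

end Evaluation

lemma isArithmetic_conj (𝒢 : Subgroup (GL (Fin 2) ℝ)) [𝒢.IsArithmetic] (γ : SL(2, ℤ)) :
    (ConjAct.toConjAct (mapGL ℝ γ)⁻¹ • 𝒢).IsArithmetic := by
  rw [← map_inv]
  generalize γ⁻¹ = δ
  convert Subgroup.IsArithmetic.conj 𝒢 (mapGL ℚ δ)
  ext i j
  simp [mapGL]

lemma tendsto_slash_atImInfty {𝒢 : Subgroup (GL (Fin 2) ℝ)} [𝒢.IsArithmetic] {k : ℤ}
    (f : ModularForm 𝒢 k) (γ : SL(2, ℤ)) :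
    Tendsto ((f : ℍ → ℂ) ∣[k] γ) atImInfty (𝓝 (valueAtInfty ((f : ℍ → ℂ) ∣[k] γ))) := by
  have := isArithmetic_conj 𝒢 γ
  obtain ⟨c, hc, hO⟩ := ModularFormClass.exp_decay_sub_atImInfty' (translate f (mapGL ℝ γ))
  have hlim : Tendsto (fun τ : ℍ => Real.exp (-c * τ.im)) atImInfty (𝓝 0) := by
    refine Real.tendsto_exp_atBot.comp ?_
    exact (tendsto_comap (f := UpperHalfPlane.im)).const_mul_atTop_of_neg (neg_neg_of_pos hc)
  have h0 := hO.trans_tendsto hlim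
  rw [coe_translate] at h0
  change Tendsto (fun τ => ((f : ℍ → ℂ) ∣[k] γ) τ - valueAtInfty ((f : ℍ → ℂ) ∣[k] γ))
    atImInfty (𝓝 0) at h0
  simpa only [sub_add_cancel, zero_add] using h0.add_const (valueAtInfty ((f : ℍ → ℂ) ∣[k] γ))

section Cusps

variable {𝒢 : Subgroup (GL (Fin 2) ℝ)} [𝒢.HasDetOne] [𝒢.IsArithmetic]

/-- The value of an element of the graded ring at the cusp `γ • ∞`: the limit of `evalAt γ τ t`
as `τ` tends to `i∞`. -/
noncomputable def cuspVal (γ : SL(2, ℤ)) (t : ℂˣ) : (⨁ k : ℤ, ModularForm 𝒢 k) →ₐ[ℂ] ℂ :=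
  DirectSum.toAlgebra ℂ (ModularForm 𝒢)
    (fun k =>
      { toFun := fun f => valueAtInfty ((f : ℍ → ℂ) ∣[k] γ) * (t : ℂ) ^ k
        map_add' := fun f g => by
          rw [← add_mul]
          congr 1
          refine tendsto_nhds_unique (tendsto_slash_atImInfty (f + g) γ) ?_
          rw [FunLike.coe_add, SlashAction.add_slash]
          exact (tendsto_slash_atImInfty f γ).add (tendsto_slash_atImInfty g γ)
        map_smul' := fun c f => by
          rw [RingHom.id_apply, smul_eq_mul, ← mul_assoc]
          congr 1
          refine tendsto_nhds_unique (tendsto_slash_atImInfty (c • f) γ) ?_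
          rw [FunLike.coe_smul, SL_smul_slash]
          exact (tendsto_slash_atImInfty f γ).const_mul c })
    (by
      change valueAtInfty ((1 : ℍ → ℂ) ∣[(0 : ℤ)] γ) * (t : ℂ) ^ (0 : ℤ) = 1
      rw [is_invariant_one, zpow_zero, mul_one]
      exact tendsto_const_nhds.limUnder_eq)
    (fun {i j} f g => by
      change valueAtInfty ((f * g : ℍ → ℂ) ∣[i + j] γ) * (t : ℂ) ^ (i + j) =
        valueAtInfty ((f : ℍ → ℂ) ∣[i] γ) * (t : ℂ) ^ i *
          (valueAtInfty ((g : ℍ → ℂ) ∣[j] γ) * (t : ℂ) ^ j)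
      have : valueAtInfty ((f * g : ℍ → ℂ) ∣[i + j] γ) =
          valueAtInfty ((f : ℍ → ℂ) ∣[i] γ) * valueAtInfty ((g : ℍ → ℂ) ∣[j] γ) := by
        rw [mul_slash_SL2]
        exact ((tendsto_slash_atImInfty f γ).mul (tendsto_slash_atImInfty g γ)).limUnder_eq
      rw [this, zpow_add₀ t.ne_zero]
      ring)

lemma cuspVal_of (γ : SL(2, ℤ)) (t : ℂˣ) (k : ℤ) (f : ModularForm 𝒢 k) :
    cuspVal γ t (DirectSum.of (ModularForm 𝒢) k f) =
      valueAtInfty ((f : ℍ → ℂ) ∣[k] γ) * (t : ℂ) ^ k := by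
  rw [cuspVal, DirectSum.toAlgebra_apply]
  exact DirectSum.toSemiring_of _ _ _ _ _

lemma tendsto_evalAt (γ : SL(2, ℤ)) (t : ℂˣ) (x : ⨁ k : ℤ, ModularForm 𝒢 k) :
    Tendsto (fun τ => evalAt γ τ t x) atImInfty (𝓝 (cuspVal γ t x)) := by
  induction x using DirectSum.induction_on with
  | zero => simp
  | of k f =>
    simp only [evalAt_of, cuspVal_of]
    exact (tendsto_slash_atImInfty f γ).mul_const _
  | add x y hx hy => simpa only [map_add] using hx.add hy

end Cusps

/-! ### Homogeneous elements -/

section Homogeneous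

variable {𝒢 : Subgroup (GL (Fin 2) ℝ)} [𝒢.HasDetOne]

lemma of_smul_form {k : ℤ} (c : ℂ) (f : ModularForm 𝒢 k) :
    DirectSum.of (ModularForm 𝒢) k (c • f) = c • DirectSum.of (ModularForm 𝒢) k f :=
  (DirectSum.lof ℂ ℤ (ModularForm 𝒢) k).map_smul c f

/-- An element of the graded ring of modular forms is homogeneous of weight `k`. -/
def IsHom (k : ℤ) (x : ⨁ k : ℤ, ModularForm 𝒢 k) : Prop :=
  ∃ f : ModularForm 𝒢 k, x = DirectSum.of (ModularForm 𝒢) k f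

lemma isHom_one : IsHom 0 (1 : ⨁ k : ℤ, ModularForm 𝒢 k) := ⟨1, rfl⟩

variable {k l : ℤ} {x y : ⨁ k : ℤ, ModularForm 𝒢 k}

lemma IsHom.mul (hx : IsHom k x) (hy : IsHom l y) : IsHom (k + l) (x * y) := by
  obtain ⟨f, rfl⟩ := hx
  obtain ⟨g, rfl⟩ := hy
  exact ⟨_, DirectSum.of_mul_of f g⟩

lemma IsHom.add (hx : IsHom k x) (hy : IsHom k y) : IsHom k (x + y) := by
  obtain ⟨f, rfl⟩ := hx
  obtain ⟨g, rfl⟩ := hy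
  exact ⟨_, (map_add _ f g).symm⟩

lemma IsHom.smul (c : ℂ) (hx : IsHom k x) : IsHom k (c • x) := by
  obtain ⟨f, rfl⟩ := hx
  exact ⟨c • f, (of_smul_form c f).symm⟩

lemma IsHom.pow (hx : IsHom k x) (n : ℕ) : IsHom (n * k) (x ^ n) := by
  induction n with
  | zero => simpa using isHom_one
  | succ n ih =>
    rw [pow_succ, Nat.cast_succ, add_one_mul]
    exact ih.mul hx

end Homogeneous

/-! ### The graded ring of full level -/

lemma evalAt_slash (γ : SL(2, ℤ)) (τ : ℍ) (t : ℂˣ) (x : R1) :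
    evalAt γ τ t x = evalAt 1 τ t x := by
  induction x using DirectSum.induction_on with
  | zero => simp
  | of k f =>
    have h : (f : ℍ → ℂ) ∣[k] γ = f := f.slash_action_eq' _ ⟨γ, rfl⟩
    rw [evalAt_of, evalAt_one_of, h]
  | add x y hx hy => rw [map_add, map_add, hx, hy]

/-- The modular discriminant `Δ` in the graded ring. -/
noncomputable def Δg : R1 :=
  DirectSum.of (ModularForm 𝒮ℒ) 12 (CuspForm.toModularFormₗ CuspForm.discriminant)

lemma evalAt_Δg (τ : ℍ) (t : ℂˣ) : evalAt 1 τ t Δg = discriminant τ * (t : ℂ) ^ 12 := by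
  rw [Δg, evalAt_one_of]
  rfl

lemma evalAt_Δg_ne_zero (τ : ℍ) (t : ℂˣ) : evalAt 1 τ t Δg ≠ 0 := by
  rw [evalAt_Δg]
  exact mul_ne_zero (discriminant_ne_zero τ) (pow_ne_zero _ t.ne_zero)

lemma evalAt_a (τ : ℍ) (t : ℂˣ) : evalAt 1 τ t a = -(1 / 3) * E₄ τ * (t : ℂ) ^ 4 := by
  rw [a, evalAt_one_of]
  rfl

lemma evalAt_b (τ : ℍ) (t : ℂˣ) : evalAt 1 τ t b = 2 / 27 * E₆ τ * (t : ℂ) ^ 6 := by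
  rw [b, evalAt_one_of]
  rfl

/-- The discriminant of the cubic `x ^ 3 + a x + b` is a multiple of `Δ`. -/
lemma disc_eq : -4 * a ^ 3 - 27 * b ^ 2 = (256 : ℂ) • Δg := by
  refine ext_evalAt fun τ t => ?_
  rw [map_smul, evalAt_Δg, discriminant_eq_E₄_cube_sub_E₆_sq]
  simp only [map_sub, map_mul, map_neg, map_pow, map_ofNat, evalAt_a, evalAt_b, smul_eq_mul]
  ring

lemma valueAtInfty_eq_coeff {k : ℤ} (f : ModularForm 𝒮ℒ k) :
    valueAtInfty f = (qExpansion 1 f).coeff 0 :=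
  (qExpansion_coeff_zero one_pos
    (ModularFormClass.analyticAt_cuspFunction_zero f one_pos one_mem_strictPeriods_SL)
    (SlashInvariantFormClass.periodic_comp_ofComplex f one_mem_strictPeriods_SL)).symm

lemma cuspVal_one_of {𝒢 : Subgroup (GL (Fin 2) ℝ)} [𝒢.HasDetOne] [𝒢.IsArithmetic] (t : ℂˣ)
    (k : ℤ) (f : ModularForm 𝒢 k) :
    cuspVal 1 t (DirectSum.of (ModularForm 𝒢) k f) = valueAtInfty f * (t : ℂ) ^ k := by
  rw [cuspVal_of, SlashAction.slash_one]

lemma cuspVal_a (t : ℂˣ) : cuspVal 1 t a = -(1 / 3) * (t : ℂ) ^ 4 := by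
  rw [a, of_smul_form, map_smul, cuspVal_one_of,
    valueAtInfty_eq_coeff, EisensteinSeries.E_qExpansion_coeff_zero _ ⟨2, rfl⟩, one_mul]
  rfl

lemma cuspVal_b (t : ℂˣ) : cuspVal 1 t b = 2 / 27 * (t : ℂ) ^ 6 := by
  rw [b, of_smul_form, map_smul, cuspVal_one_of,
    valueAtInfty_eq_coeff, EisensteinSeries.E_qExpansion_coeff_zero _ ⟨3, rfl⟩, one_mul]
  rfl

lemma isHom_a : IsHom 4 a := ⟨_, rfl⟩

lemma isHom_b : IsHom 6 b := ⟨_, rfl⟩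

lemma isHom_e : IsHom 2 e := ⟨_, rfl⟩

/-- A form of full level that vanishes at the cusp is a multiple of `Δ`. -/
lemma exists_eq_Δg_mul {k : ℤ} (f : ModularForm 𝒮ℒ k) (hf : valueAtInfty f = 0) :
    ∃ g : ModularForm 𝒮ℒ (k - 12),
      DirectSum.of (ModularForm 𝒮ℒ) k f = Δg * DirectSum.of (ModularForm 𝒮ℒ) (k - 12) g := by
  rw [valueAtInfty_eq_coeff] at hf
  refine ⟨CuspForm.discriminantEquiv (toCuspForm f hf), ext_evalAt fun τ t => ?_⟩
  rw [map_mul, evalAt_Δg, evalAt_one_of, evalAt_one_of, CuspForm.discriminantEquiv_apply,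
    toCuspForm_apply, zpow_sub₀ t.ne_zero,
    zpow_ofNat]
  have h1 := discriminant_ne_zero τ
  have h2 := t.ne_zero
  field_simp

lemma Δg_dvd {x : R1} (h : ∀ t, cuspVal 1 t x = 0) : Δg ∣ x := by
  classical
  have hx : ∀ t : ℂˣ, ∑ k ∈ x.support, valueAtInfty (x k) * (t : ℂ) ^ k = 0 := by
    intro t
    rw [← h t]
    conv_rhs => rw [← DirectSum.sum_support_of x, map_sum]
    exact Finset.sum_congr rfl fun k _ => (cuspVal_one_of t k _).symm
  rw [← DirectSum.sum_support_of x]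
  refine Finset.dvd_sum fun k hk => ?_
  obtain ⟨g, hg⟩ := exists_eq_Δg_mul (x k)
    (forall_eq_zero_of_sum_mul_zpow (c := fun k => valueAtInfty (x k)) hx k hk)
  exact ⟨_, hg⟩

/-- A form of full level and weight less than `12` is zero if it vanishes at the cusp. -/
lemma IsHom.eq_zero_of_cuspVal {k : ℤ} {x : R1} (hx : IsHom k x) (hk : k < 12)
    (h : cuspVal 1 1 x = 0) : x = 0 := by
  obtain ⟨f, rfl⟩ := hx
  rw [cuspVal_one_of, Units.val_one, one_zpow, mul_one] at h
  obtain ⟨g, hg⟩ := exists_eq_Δg_mul f h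
  rw [hg, isZero_of_neg_weight (by omega) g, map_zero, mul_zero]

lemma IsHom.eq_zero_of_weight_two {x : R1} (hx : IsHom 2 x) : x = 0 := by
  obtain ⟨f, rfl⟩ := hx
  rw [rank_zero_iff_forall_zero.mp levelOne_weight_two_rank_zero f, map_zero]

/-! ### The ring of full level is the polynomial ring in `a` and `b` -/

/-- Induction on the weight: a multiple of a monomial `a ^ i b ^ j` is subtracted to make the value
at the cusp zero, and the difference is divided by `Δ`. -/
lemma of_mem_range (n : ℕ) : ∀ (k : ℤ), k.toNat = n → ∀ f : ModularForm 𝒮ℒ k,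
    DirectSum.of (ModularForm 𝒮ℒ) k f ∈
      (MvPolynomial.aeval ![a, b] : MvPolynomial (Fin 2) ℂ →ₐ[ℂ] R1).range := by
  set S := (MvPolynomial.aeval ![a, b] : MvPolynomial (Fin 2) ℂ →ₐ[ℂ] R1).range
  have ha : a ∈ S := ⟨MvPolynomial.X 0, by simp⟩
  have hb : b ∈ S := ⟨MvPolynomial.X 1, by simp⟩
  have hΔ : Δg ∈ S := by
    have h : Δg = (1 / 256 : ℂ) • (-4 * a ^ 3 - 27 * b ^ 2) := by
      rw [disc_eq, smul_smul]
      norm_num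
    rw [h]
    exact S.smul_mem (S.sub_mem (S.mul_mem (S.neg_mem (ofNat_mem S 4)) (S.pow_mem ha 3))
      (S.mul_mem (ofNat_mem S 27) (S.pow_mem hb 2))) _
  induction n using Nat.strong_induction_on with | h n ih =>
  intro k hk f
  rcases lt_or_ge k 0 with hneg | hpos
  · rw [isZero_of_neg_weight hneg f, map_zero]
    exact S.zero_mem
  rcases Int.even_or_odd k with heven | hodd
  swap
  · rw [levelOne_odd_weight_eq_zero hodd f, map_zero]
    exact S.zero_mem
  obtain rfl | h0 := eq_or_ne k 0
  · obtain ⟨c, hc⟩ := ModularFormClass.levelOne_weight_zero_const f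
    have : DirectSum.of (ModularForm 𝒮ℒ) 0 f = algebraMap ℂ R1 c := by
      rw [DirectSum.algebraMap_apply]
      congr 1
      ext τ
      rw [hc]
      rfl
    rw [this]
    exact S.algebraMap_mem c
  obtain rfl | h2 := eq_or_ne k 2
  · rw [IsHom.eq_zero_of_weight_two ⟨f, rfl⟩]
    exact S.zero_mem
  obtain ⟨i, j, hij⟩ : ∃ i j : ℕ, (i * 4 + j * 6 : ℤ) = k := by
    obtain ⟨m, rfl⟩ := heven
    rcases Int.even_or_odd m with ⟨l, rfl⟩ | ⟨l, rfl⟩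
    · exact ⟨l.toNat, 0, by omega⟩
    · exact ⟨(l - 1).toNat, 1, by omega⟩
  obtain ⟨g, hg⟩ : IsHom k (a ^ i * b ^ j) := hij ▸ (isHom_a.pow i).mul (isHom_b.pow j)
  have hgS : DirectSum.of (ModularForm 𝒮ℒ) k g ∈ S :=
    hg ▸ S.mul_mem (S.pow_mem ha i) (S.pow_mem hb j)
  have hg0 : valueAtInfty g ≠ 0 := by
    have := congrArg (cuspVal 1 1) hg
    rw [cuspVal_one_of, map_mul, map_pow, map_pow, cuspVal_a, cuspVal_b] at this
    intro h
    rw [h, zero_mul] at this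
    simp at this
  set c := valueAtInfty f / valueAtInfty g with hc
  have hsub : DirectSum.of (ModularForm 𝒮ℒ) k (f - c • g) =
      DirectSum.of (ModularForm 𝒮ℒ) k f - c • DirectSum.of (ModularForm 𝒮ℒ) k g := by
    rw [← of_smul_form, ← map_sub]
  have hval : valueAtInfty (f - c • g : ModularForm 𝒮ℒ k) = 0 := by
    have h := cuspVal_one_of 1 k (f - c • g)
    rw [hsub, map_sub, map_smul, cuspVal_one_of, cuspVal_one_of, Units.val_one, one_zpow, mul_one,
      mul_one, mul_one, smul_eq_mul, hc, div_mul_cancel₀ _ hg0, sub_self] at h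
    exact h.symm
  obtain ⟨h, hh⟩ := exists_eq_Δg_mul (f - c • g) hval
  rw [hsub, sub_eq_iff_eq_add] at hh
  rw [hh]
  refine S.add_mem (S.mul_mem hΔ ?_) (S.smul_mem hgS _)
  rcases lt_or_ge (k - 12) 0 with hlt | hge
  · rw [isZero_of_neg_weight hlt h, map_zero]
    exact S.zero_mem
  · exact ih (k - 12).toNat (by omega) (k - 12) rfl h

lemma aeval_surjective :
    Function.Surjective (MvPolynomial.aeval ![a, b] : MvPolynomial (Fin 2) ℂ →ₐ[ℂ] R1) := by
  intro x
  rw [← AlgHom.mem_range]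
  induction x using DirectSum.induction_on with
  | zero => exact Subalgebra.zero_mem _
  | of k f => exact of_mem_range _ k rfl f
  | add x y hx hy => exact Subalgebra.add_mem _ hx hy

open Polynomial in
/-- A polynomial relation `r + s b = 0` with `r`, `s` polynomials in `a` is trivial, even if it
is only assumed at the cusp. -/
lemma eq_zero_of_cuspVal_linear (r s : ℂ[X])
    (h : ∀ t, cuspVal 1 t (aeval a r + aeval a s * b) = 0) : r = 0 ∧ s = 0 := by
  have key : ∀ x : ℂ, x ≠ 0 → r.eval x = 0 ∧ s.eval x = 0 := by
    intro x hx
    obtain ⟨u, hu⟩ := IsAlgClosed.exists_pow_nat_eq (-3 * x) (n := 4) (by norm_num)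
    have hu0 : u ≠ 0 := by
      rintro rfl
      simp [hx] at hu
    -- The points `u` and `i u` give the same value of `a` and opposite values of `b`.
    have h1 := h (Units.mk0 u hu0)
    have h2 := h (Units.mk0 (Complex.I * u) (mul_ne_zero Complex.I_ne_zero hu0))
    have e1 : -(1 / 3) * u ^ 4 = x := by rw [hu]; ring
    have hI6 : Complex.I ^ 6 = -1 := by
      rw [show (6 : ℕ) = 4 + 2 from rfl, pow_add, Complex.I_pow_four, Complex.I_sq, one_mul]
    simp only [map_add, map_mul, ← aeval_algHom_apply, cuspVal_a, cuspVal_b, Units.val_mk0,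
      mul_pow, Complex.I_pow_four, one_mul, e1, hI6, coe_aeval_eq_eval] at h1 h2
    constructor
    · linear_combination (h1 + h2) / 2
    · have : s.eval x * u ^ 6 = 0 := by linear_combination (27 / 4) * (h1 - h2)
      exact (mul_eq_zero.mp this).resolve_right (pow_ne_zero _ hu0)
  constructor <;>
    refine eq_zero_of_infinite_isRoot _
      (Set.Infinite.mono ?_ (Set.finite_singleton (0 : ℂ)).infinite_compl) <;>
    intro x hx
  · exact (key x hx).1
  · exact (key x hx).2

lemma Δg_mul_eq_zero {x : R1} (h : Δg * x = 0) : x = 0 := by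
  refine eq_zero_of_evalAt fun τ t => ?_
  have := congrArg (evalAt 1 τ t) h
  rw [map_mul, map_zero] at this
  exact (mul_eq_zero.mp this).resolve_left (evalAt_Δg_ne_zero τ t)

open Polynomial in
/-- A relation between `a` and `b` is divided by the monic quadratic polynomial in `b` whose
value is a multiple of `Δ`. The remainder vanishes at the cusp, so it is zero, and the quotient is again a
relation, of smaller degree. -/
lemma eval₂_injective :
    Function.Injective (eval₂RingHom (aeval a : ℂ[X] →ₐ[ℂ] R1).toRingHom b) := by
  set Φ := eval₂RingHom (aeval a : ℂ[X] →ₐ[ℂ] R1).toRingHom b with hΦ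
  -- `D` is the monic quadratic polynomial in `b` whose value is a multiple of `Δ`.
  set D : ℂ[X][X] := X ^ 2 + C (C (4 / 27 : ℂ) * X ^ 3) with hD
  have hDm : D.Monic := monic_X_pow_add_C _ two_ne_zero
  have hDd : D.natDegree = 2 := natDegree_X_pow_add_C
  have hΦD : Φ D = (-256 / 27 : ℂ) • Δg := by
    have h : (-1 / 27 : ℂ) • (-4 * a ^ 3 - 27 * b ^ 2) = (-256 / 27 : ℂ) • Δg := by
      rw [disc_eq, smul_smul]
      norm_num
    rw [← h]
    have hΦD' : Φ D = b ^ 2 + algebraMap ℂ R1 (4 / 27) * a ^ 3 := by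
      rw [hΦ, hD, coe_eval₂RingHom, eval₂_add, eval₂_X_pow, eval₂_C]
      simp
    rw [hΦD']
    rw [Algebra.smul_def, mul_sub, ← map_ofNat (algebraMap ℂ R1) 27,
      ← map_ofNat (algebraMap ℂ R1) 4, ← map_neg, ← mul_assoc, ← mul_assoc, ← map_mul, ← map_mul]
    norm_num
    ring
  have hcusp : ∀ t, cuspVal 1 t (Φ D) = 0 := by
    intro t
    have h := congrArg (cuspVal 1 t) disc_eq
    simp only [map_sub, map_mul, map_neg, map_pow, map_ofNat, cuspVal_a, cuspVal_b, map_smul] at h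
    rw [hΦD, map_smul]
    simp only [smul_eq_mul] at h ⊢
    linear_combination (-1 / 27 : ℂ) * -h
  rw [injective_iff_map_eq_zero]
  intro p hp
  induction hn : p.natDegree using Nat.strong_induction_on generalizing p with | h n ih =>
  have hdiv := modByMonic_add_div p D
  have hlt : (p %ₘ D).degree ≤ 1 := by
    have := degree_modByMonic_lt p hDm
    rw [degree_eq_natDegree hDm.ne_zero, hDd] at this
    exact Order.le_of_lt_succ this
  have hr : p %ₘ D = 0 := by
    rw [eq_X_add_C_of_degree_le_one hlt]
    have h0 : ∀ t, cuspVal 1 t (Φ (p %ₘ D)) = 0 := by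
      intro t
      have := congrArg (fun q => cuspVal 1 t (Φ q)) hdiv
      simpa [hp, hcusp] using this
    rw [eq_X_add_C_of_degree_le_one hlt] at h0
    obtain ⟨h1, h2⟩ := eq_zero_of_cuspVal_linear ((p %ₘ D).coeff 0) ((p %ₘ D).coeff 1) (by
      intro t
      rw [← h0 t, hΦ]
      simp [add_comm])
    rw [h1, h2]
    simp
  rw [hr, zero_add] at hdiv
  have hq : Φ (p /ₘ D) = 0 := by
    have := congrArg Φ hdiv
    rw [map_mul, hp, hΦD, smul_mul_assoc] at this
    exact Δg_mul_eq_zero ((smul_eq_zero.mp this).resolve_left (by norm_num))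
  by_cases h2 : p.natDegree < 2
  · rw [← hdiv, (divByMonic_eq_zero_iff hDm).mpr, mul_zero]
    rw [degree_eq_natDegree hDm.ne_zero, hDd]
    exact degree_le_natDegree.trans_lt (by exact_mod_cast h2)
  · rw [← hdiv, ih (p /ₘ D).natDegree _ _ hq rfl, mul_zero]
    rw [natDegree_divByMonic p hDm, hDd]
    omega

open Polynomial in
lemma aeval_injective :
    Function.Injective (MvPolynomial.aeval ![a, b] : MvPolynomial (Fin 2) ℂ →ₐ[ℂ] R1) := by
  set ε : MvPolynomial (Fin 2) ℂ →ₐ[ℂ] ℂ[X][X] := MvPolynomial.aeval ![C X, X] with hε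
  have hinj : Function.Injective ε := by
    refine Function.LeftInverse.injective (g := eval₂RingHom
      (aeval (MvPolynomial.X 0) : ℂ[X] →ₐ[ℂ] MvPolynomial (Fin 2) ℂ).toRingHom
      (MvPolynomial.X 1)) fun p => ?_
    induction p using MvPolynomial.induction_on with
    | C c => simp [hε, MvPolynomial.algebraMap_eq]
    | add p q hp hq => rw [map_add, map_add, hp, hq]
    | mul_X p i hp =>
      rw [map_mul, map_mul, hp]
      fin_cases i <;> simp [hε]
  have hcomp : ∀ p, MvPolynomial.aeval ![a, b] p =
      eval₂RingHom (aeval a : ℂ[X] →ₐ[ℂ] R1).toRingHom b (ε p) := by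
    intro p
    induction p using MvPolynomial.induction_on with
    | C c => simp [hε]
    | add p q hp hq => rw [map_add, map_add, map_add, hp, hq]
    | mul_X p i hp =>
      rw [map_mul, map_mul, map_mul, hp]
      fin_cases i <;> simp [hε]
  intro p q h
  rw [hcomp, hcomp] at h
  exact hinj (eval₂_injective h)

instance : IsDomain R1 :=
  (AlgEquiv.ofBijective _ ⟨aeval_injective, aeval_surjective⟩).symm.toMulEquiv.isDomain
    (MvPolynomial (Fin 2) ℂ)

/-! ### The trace from `Γ₀(2)` to full level -/

open ModularGroup (S T)

lemma smul_eq_incl_mul (x : R1) (y : R2) : x • y = incl x * y := rfl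

/-- The inclusion of the forms of full level in weight `k`, as a linear map. -/
noncomputable def resLin (k : ℤ) : ModularForm 𝒮ℒ k →ₗ[ℂ] ModularForm G02 k where
  toFun := resForm
  map_add' _ _ := rfl
  map_smul' _ _ := rfl

lemma incl_of {k : ℤ} (f : ModularForm 𝒮ℒ k) :
    incl (DirectSum.of (ModularForm 𝒮ℒ) k f) = DirectSum.of (ModularForm G02) k (resForm f) := by
  exact DirectSum.toAddMonoid_of
    (fun k => ((DirectSum.lof ℂ ℤ (ModularForm G02) k).comp (resLin k)).toAddMonoidHom) k f

lemma IsHom.incl {k : ℤ} {x : R1} (hx : IsHom k x) : IsHom k (HeckeGen.incl x) := by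
  obtain ⟨f, rfl⟩ := hx
  exact ⟨_, incl_of f⟩

lemma evalAt_incl (γ : SL(2, ℤ)) (τ : ℍ) (t : ℂˣ) (x : R1) :
    evalAt γ τ t (incl x) = evalAt 1 τ t x := by
  rw [← evalAt_slash γ]
  induction x using DirectSum.induction_on with
  | zero => simp
  | of k f =>
    rw [incl_of, evalAt_of, evalAt_of]
    rfl
  | add x y hx hy => rw [map_add, map_add, map_add, hx, hy]

lemma cuspVal_incl (γ : SL(2, ℤ)) (t : ℂˣ) (x : R1) :
    cuspVal γ t (incl x) = cuspVal 1 t x := by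
  refine tendsto_nhds_unique (tendsto_evalAt γ t (incl x)) ?_
  simp only [evalAt_incl]
  exact tendsto_evalAt 1 t x

section

variable {k : ℤ} (f : ModularForm G02 k)

lemma slash_eq_of_mem {γ δ ε : SL(2, ℤ)} (h : γ = δ * ε) (hδ : δ ∈ Gamma0 2) :
    (f : ℍ → ℂ) ∣[k] γ = (f : ℍ → ℂ) ∣[k] ε := by
  have hf : (f : ℍ → ℂ) ∣[k] δ = f := f.slash_action_eq' _ ⟨δ, hδ, rfl⟩
  rw [h, SlashAction.slash_mul, hf]

/-- The function `f + f ∣ S + f ∣ S T`: the cosets of `Γ₀(2)` in `SL(2, ℤ)` are represented by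
`1`, `S`, `S T`. -/
noncomputable def traceFun : ℍ → ℂ :=
  (f : ℍ → ℂ) + (f : ℍ → ℂ) ∣[k] S + (f : ℍ → ℂ) ∣[k] (S * T)

lemma traceFun_slash (γ : SL(2, ℤ)) : traceFun f ∣[k] γ = traceFun f := by
  have h1 : (f : ℍ → ℂ) ∣[k] T = f := by
    rw [slash_eq_of_mem f (mul_one T).symm (by rw [Gamma0_mem]; decide),
      SlashAction.slash_one]
  have h2 : (f : ℍ → ℂ) ∣[k] (S * S) = f := by
    rw [slash_eq_of_mem f (mul_one (S * S)).symm (by rw [Gamma0_mem]; decide),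
      SlashAction.slash_one]
  have h3 : (f : ℍ → ℂ) ∣[k] (S * T * S) = (f : ℍ → ℂ) ∣[k] (S * T) := by
    refine slash_eq_of_mem f (δ := S * T * S * (S * T)⁻¹) (inv_mul_cancel_right _ _).symm ?_
    rw [Gamma0_mem]
    decide
  have h4 : (f : ℍ → ℂ) ∣[k] (S * T * T) = (f : ℍ → ℂ) ∣[k] S := by
    refine slash_eq_of_mem f (δ := S * T * T * S⁻¹) (inv_mul_cancel_right _ _).symm ?_
    rw [Gamma0_mem]
    decide
  refine SlashInvariantForm.slash_action_generators_SL2Z ?_ ?_ γ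
  · rw [traceFun, SlashAction.add_slash, SlashAction.add_slash, ← SlashAction.slash_mul, h2,
      ← SlashAction.slash_mul, h3]
    abel
  · rw [traceFun, SlashAction.add_slash, SlashAction.add_slash, ← SlashAction.slash_mul, h1,
      ← SlashAction.slash_mul, h4]
    abel

/-- The trace of a modular form on `Γ₀(2)`, as a form of full level. -/
noncomputable def traceForm : ModularForm 𝒮ℒ k where
  toFun := traceFun f
  slash_action_eq' := by
    rintro _ ⟨γ, rfl⟩
    exact traceFun_slash f γ
  holo' := (f.holo'.add (f.holo'.slash k _)).add (f.holo'.slash k _)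
  bdd_at_cusps' hc := by
    rw [OnePoint.isBoundedAt_iff_forall_SL2Z hc]
    intro γ _
    rw [traceFun_slash]
    exact ((ModularFormClass.bdd_at_infty f).add (ModularFormClass.bdd_at_infty_slash f S)).add
      (ModularFormClass.bdd_at_infty_slash f (S * T))

end

/-- The trace in weight `k`, as a linear map. -/
noncomputable def traceLin (k : ℤ) : ModularForm G02 k →ₗ[ℂ] ModularForm 𝒮ℒ k where
  toFun := traceForm
  map_add' f g := by
    ext τ
    change traceFun (f + g) τ = traceFun f τ + traceFun g τ
    simp only [traceFun, FunLike.coe_add, SlashAction.add_slash, Pi.add_apply]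
    ring
  map_smul' c f := by
    ext τ
    change traceFun (c • f) τ = c * traceFun f τ
    simp only [traceFun, FunLike.coe_smul, SL_smul_slash, Pi.add_apply, Pi.smul_apply, smul_eq_mul]
    ring

/-- The trace from the graded ring of `Γ₀(2)` to that of full level, as a `ℂ`-linear map. -/
noncomputable def traceC : R2 →ₗ[ℂ] R1 :=
  DirectSum.toModule ℂ ℤ R1 fun k => (DirectSum.lof ℂ ℤ (ModularForm 𝒮ℒ) k).comp (traceLin k)

lemma traceC_of {k : ℤ} (f : ModularForm G02 k) :
    traceC (DirectSum.of (ModularForm G02) k f) =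
      DirectSum.of (ModularForm 𝒮ℒ) k (traceForm f) := by
  rw [traceC, ← DirectSum.lof_eq_of ℂ, DirectSum.toModule_lof]
  rfl

lemma evalAt_traceC (τ : ℍ) (t : ℂˣ) (x : R2) :
    evalAt 1 τ t (traceC x) = evalAt 1 τ t x + evalAt S τ t x + evalAt (S * T) τ t x := by
  induction x using DirectSum.induction_on with
  | zero => simp
  | of k f =>
    rw [traceC_of, evalAt_one_of, evalAt_one_of, evalAt_of, evalAt_of, ← add_mul, ← add_mul]
    rfl
  | add x y hx hy =>
    simp only [map_add, hx, hy]
    ring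

/-- The trace from the graded ring of `Γ₀(2)` to that of full level. -/
noncomputable def trace : R2 →ₗ[R1] R1 where
  toFun := traceC
  map_add' := map_add traceC
  map_smul' x y := ext_evalAt fun τ t => by
    rw [RingHom.id_apply, smul_eq_incl_mul, smul_eq_mul, map_mul (evalAt 1 τ t)]
    simp only [evalAt_traceC, map_mul (evalAt _ τ t), evalAt_incl]
    ring

lemma evalAt_trace (τ : ℍ) (t : ℂˣ) (x : R2) :
    evalAt 1 τ t (trace x) = evalAt 1 τ t x + evalAt S τ t x + evalAt (S * T) τ t x :=
  evalAt_traceC τ t x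

lemma IsHom.trace {k : ℤ} {x : R2} (hx : IsHom k x) : IsHom k (HeckeGen.trace x) := by
  obtain ⟨f, rfl⟩ := hx
  exact ⟨_, traceC_of f⟩

/-- The translate by `T` does not change the limit at `i∞`. -/
lemma cuspVal_mul_T (γ : SL(2, ℤ)) (t : ℂˣ) (x : R2) : cuspVal (γ * T) t x = cuspVal γ t x := by
  have hT : Tendsto (fun τ : ℍ => T • τ) atImInfty atImInfty := by
    refine tendsto_comap_iff.mpr ?_
    have : UpperHalfPlane.im ∘ (fun τ : ℍ => T • τ) = UpperHalfPlane.im := by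
      ext τ
      rw [Function.comp_apply, modular_T_smul]
      simp
    rw [this]
    exact tendsto_comap
  have h : ∀ τ, evalAt (γ * T) τ t x = evalAt γ (T • τ) t x := by
    intro τ
    induction x using DirectSum.induction_on with
    | zero => simp
    | of k f =>
      have hd : denom (T : GL (Fin 2) ℝ) τ = 1 := by
        rw [ModularGroup.denom_apply]
        simp [ModularGroup.T]
      rw [evalAt_of, evalAt_of, SlashAction.slash_mul, SL_slash_apply, hd, one_zpow, mul_one]
    | add x y hx hy => rw [map_add, map_add, hx, hy]
  refine tendsto_nhds_unique (tendsto_evalAt (γ * T) t x) ?_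
  simp only [h]
  exact (tendsto_evalAt γ t x).comp hT

lemma cuspVal_trace (t : ℂˣ) (x : R2) :
    cuspVal 1 t (trace x) = cuspVal 1 t x + 2 * cuspVal S t x := by
  refine tendsto_nhds_unique (tendsto_evalAt 1 t (trace x)) ?_
  simp only [evalAt_trace]
  have h := ((tendsto_evalAt 1 t x).add (tendsto_evalAt S t x)).add (tendsto_evalAt (S * T) t x)
  rw [cuspVal_mul_T] at h
  convert h using 2
  ring

/-! ### The cubic equation of `e` -/

lemma tendsto_dbl : Tendsto dbl atImInfty atImInfty := by
  refine tendsto_comap_iff.mpr ?_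
  have : UpperHalfPlane.im ∘ dbl = fun τ => 2 * τ.im := by
    ext τ
    simp [dbl, ← UpperHalfPlane.coe_im]
  rw [this]
  exact tendsto_comap.const_mul_atTop two_pos

lemma tendsto_halve (n : ℕ) : Tendsto (halve n) atImInfty atImInfty := by
  refine tendsto_comap_iff.mpr ?_
  have : UpperHalfPlane.im ∘ halve n = fun τ => τ.im / 2 := by
    ext τ
    simp [halve, ← UpperHalfPlane.coe_im]
  rw [this]
  exact tendsto_comap.atTop_div_const two_pos

lemma tendsto_E2 : Tendsto EisensteinSeries.E2 atImInfty (𝓝 1) := by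
  set c : ℕ → ℂ := fun m => if m = 0 then 1 else -24 * ArithmeticFunction.sigma 1 m with hc
  have hE : ∀ τ : ℍ, HasSum (fun m => c m • Function.Periodic.qParam 1 τ ^ m)
      (EisensteinSeries.E2 τ) := fun τ => by
    simpa only [Function.Periodic.qParam, Complex.ofReal_one, div_one] using
      EisensteinSeries.hasSum_qExpansion_E2 (z := τ)
  -- `(E₂ - 1) / q` has a power series expansion in `q`, so it is bounded.
  have hb : IsBoundedAtImInfty fun τ : ℍ =>
      (EisensteinSeries.E2 τ - 1) * (Function.Periodic.qParam 1 τ)⁻¹ := by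
    refine isBoundedAtImInfty_of_hasSum_qExpansion (c := fun m => c (m + 1)) one_pos fun τ => ?_
    have h := ((hasSum_nat_add_iff' 1).mpr (hE τ)).mul_right (Function.Periodic.qParam 1 τ)⁻¹
    simp only [Finset.range_one, Finset.sum_singleton, pow_zero, smul_eq_mul, mul_one] at h
    refine h.congr_fun fun m => ?_
    rw [smul_eq_mul, pow_succ, mul_assoc, mul_assoc,
      mul_inv_cancel₀ (Function.Periodic.qParam_ne_zero _), mul_one]
  have h0 := (qParam_tendsto_atImInfty one_pos).zero_mul_isBoundedUnder_le
    hb.isBoundedUnder_le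
  have h1 := h0.add_const 1
  rw [zero_add] at h1
  refine h1.congr fun τ => ?_
  rw [mul_left_comm, mul_inv_cancel₀ (Function.Periodic.qParam_ne_zero _)]
  ring

lemma cuspVal_one_e (t : ℂˣ) : cuspVal 1 t e = -(2 / 3) * (t : ℂ) ^ 2 := by
  rw [e, cuspVal_one_of]
  congr 1
  refine Tendsto.limUnder_eq ?_
  change Tendsto eFun atImInfty _
  have h : eFun = fun τ => -(2 / 3 : ℂ) * (2 * EisensteinSeries.E2 (dbl τ) -
      EisensteinSeries.E2 τ) := by
    rw [eFun_eq_E2]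
    ext τ
    rw [Pi.smul_apply, Pi.sub_apply, slash_gD]
    norm_num
  rw [h]
  have := (((tendsto_E2.comp tendsto_dbl).const_mul 2).sub tendsto_E2).const_mul (-(2 / 3 : ℂ))
  rwa [show -(2 / 3 : ℂ) * (2 * 1 - 1) = -(2 / 3) by norm_num] at this

lemma trace_e : trace e = 0 := isHom_e.trace.eq_zero_of_weight_two

lemma cuspVal_S_e (t : ℂˣ) : cuspVal S t e = 1 / 3 * (t : ℂ) ^ 2 := by
  have h := cuspVal_trace t e
  rw [trace_e, map_zero, cuspVal_one_e] at h
  linear_combination -h / 2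

lemma trace_e_sq : trace (e ^ 2) = -2 * a := by
  rw [← sub_eq_zero]
  have h : IsHom 4 (trace (e ^ 2) - -2 * a) := by
    have := (isHom_e.pow 2).trace.add (isHom_a.smul 2)
    rwa [Algebra.smul_def, map_ofNat, ← neg_neg (2 * a), ← sub_eq_add_neg, ← neg_mul] at this
  refine h.eq_zero_of_cuspVal (by norm_num) ?_
  simp only [map_sub, map_mul, map_neg, map_ofNat, cuspVal_trace, map_pow, cuspVal_one_e,
    cuspVal_S_e, cuspVal_a, Units.val_one]
  norm_num

lemma trace_e_cube : trace (e ^ 3) = -3 * b := by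
  rw [← sub_eq_zero]
  have h : IsHom 6 (trace (e ^ 3) - -3 * b) := by
    have := (isHom_e.pow 3).trace.add (isHom_b.smul 3)
    rwa [Algebra.smul_def, map_ofNat, ← neg_neg (3 * b), ← sub_eq_add_neg, ← neg_mul] at this
  refine h.eq_zero_of_cuspVal (by norm_num) ?_
  simp only [map_sub, map_mul, map_neg, map_ofNat, cuspVal_trace, map_pow, cuspVal_one_e,
    cuspVal_S_e, cuspVal_b, Units.val_one]
  norm_num

/-- The elementary symmetric functions of the three conjugates of `e`, by Newton's identities. -/
lemma conjugates_e (τ : ℍ) (t : ℂˣ) :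
    evalAt 1 τ t e + evalAt S τ t e + evalAt (S * T) τ t e = 0 ∧
    evalAt 1 τ t e * evalAt S τ t e + evalAt 1 τ t e * evalAt (S * T) τ t e +
      evalAt S τ t e * evalAt (S * T) τ t e = evalAt 1 τ t a ∧
    evalAt 1 τ t e * evalAt S τ t e * evalAt (S * T) τ t e = -evalAt 1 τ t b := by
  have h1 := congrArg (evalAt 1 τ t) trace_e
  have h2 := congrArg (evalAt 1 τ t) trace_e_sq
  have h3 := congrArg (evalAt 1 τ t) trace_e_cube
  rw [evalAt_trace, map_zero] at h1
  simp only [evalAt_trace, map_pow, map_mul, map_neg, map_ofNat] at h2 h3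
  set x := evalAt 1 τ t e
  set y := evalAt S τ t e
  set z := evalAt (S * T) τ t e
  refine ⟨h1, ?_, ?_⟩
  · linear_combination (x + y + z) / 2 * h1 - h2 / 2
  · linear_combination h3 / 3 +
      (-(x ^ 2 + y ^ 2 + z ^ 2) + (x * y + x * z + y * z)) / 3 * h1

lemma e_cube : e ^ 3 = -incl a * e - incl b := by
  refine ext_evalAt fun τ t => ?_
  obtain ⟨h1, h2, h3⟩ := conjugates_e τ t
  simp only [map_pow, map_sub, map_mul, map_neg, evalAt_incl]
  rw [← h2]
  linear_combination (evalAt 1 τ t e) ^ 2 * h1 + h3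

/-- The three conjugates of `e` are distinct at every point, because the discriminant of the
cubic is a multiple of `Δ`. -/
lemma conjugates_e_ne (τ : ℍ) (t : ℂˣ) :
    (evalAt 1 τ t e - evalAt S τ t e) * (evalAt 1 τ t e - evalAt (S * T) τ t e) *
      (evalAt S τ t e - evalAt (S * T) τ t e) ≠ 0 := by
  intro h
  obtain ⟨h1, h2, h3⟩ := conjugates_e τ t
  have hd := congrArg (evalAt 1 τ t) disc_eq
  simp only [map_smul, map_sub, map_mul, map_neg, map_pow, map_ofNat] at hd
  refine (smul_ne_zero (by norm_num : (256 : ℂ) ≠ 0) (evalAt_Δg_ne_zero τ t)) ?_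
  rw [← hd, ← h2, show evalAt 1 τ t b = -(evalAt 1 τ t e * evalAt S τ t e * evalAt (S * T) τ t e)
    by rw [h3, neg_neg]]
  have hz : evalAt (S * T) τ t e = -evalAt 1 τ t e - evalAt S τ t e := by
    linear_combination h1
  rw [hz] at h ⊢
  linear_combination ((evalAt 1 τ t e - evalAt S τ t e) *
    (evalAt 1 τ t e - (-evalAt 1 τ t e - evalAt S τ t e)) *
      (evalAt S τ t e - (-evalAt 1 τ t e - evalAt S τ t e))) * h

/-- The trace form is nondegenerate on the span of `1`, `e`, `e ^ 2`: the Vandermonde determinant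
of the conjugates of `e` does not vanish. -/
lemma eq_zero_of_trace {x : R2} (h0 : trace x = 0) (h1 : trace (x * e) = 0)
    (h2 : trace (x * e ^ 2) = 0) : x = 0 := by
  refine eq_zero_of_evalAt fun τ t => ?_
  have e0 := congrArg (evalAt 1 τ t) h0
  have e1 := congrArg (evalAt 1 τ t) h1
  have e2 := congrArg (evalAt 1 τ t) h2
  simp only [evalAt_trace, map_pow, map_mul, map_zero] at e0 e1 e2
  have hne := conjugates_e_ne τ t
  set x := evalAt 1 τ t e
  set y := evalAt S τ t e
  set z := evalAt (S * T) τ t e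
  refine (mul_eq_zero.mp ?_).resolve_left (left_ne_zero_of_mul hne)
  linear_combination e2 - (y + z) * e1 + y * z * e0

/-! ### The basis `1, e, e ^ 2` -/

lemma trace_one : trace 1 = 3 := by
  refine ext_evalAt fun τ t => ?_
  rw [evalAt_trace, map_one, map_one, map_one, map_ofNat]
  norm_num

lemma trace_e_pow_four : trace (e ^ 4) = 2 * a ^ 2 := by
  have h : e ^ 4 = (-a) • e ^ 2 + (-b) • e := by
    rw [smul_eq_incl_mul, smul_eq_incl_mul, map_neg, map_neg]
    linear_combination e * e_cube
  rw [h, map_add, map_smul, map_smul, trace_e, trace_e_sq, smul_eq_mul, smul_zero]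
  ring

/-- The discriminant of the cubic `x ^ 3 + a x + b`. -/
noncomputable def disc : R1 := -4 * a ^ 3 - 27 * b ^ 2

lemma disc_ne_zero : disc ≠ 0 := by
  intro h
  rw [disc, disc_eq] at h
  have h' := congrArg (evalAt 1 UpperHalfPlane.I 1) h
  rw [map_smul, map_zero] at h'
  exact smul_ne_zero (by norm_num) (evalAt_Δg_ne_zero _ _) h'

lemma linearIndependent_e : LinearIndependent R1 fun i : Fin 3 => e ^ (i : ℕ) := by
  rw [Fintype.linearIndependent_iff]
  intro c hc
  rw [Fin.sum_univ_three] at hc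
  simp only [Fin.val_zero, Fin.val_one, Fin.val_two, pow_zero, pow_one] at hc
  -- Pairing the relation with `1`, `e`, `e ^ 2` gives a linear system with determinant `disc`.
  have h0 := congrArg trace hc
  have h1 := congrArg (fun x => trace (x * e)) hc
  have h2 := congrArg (fun x => trace (x * e ^ 2)) hc
  have h4 : (e ^ 2) ^ 2 = e ^ 4 := by ring
  simp only [add_mul, smul_mul_assoc, one_mul, zero_mul, ← pow_succ, ← pow_succ', ← sq, h4,
    map_add, map_smul, map_zero, Nat.reduceAdd, smul_eq_mul, trace_one, trace_e, trace_e_sq,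
    trace_e_cube, trace_e_pow_four] at h0 h1 h2
  have e0 : disc * c 0 = 0 := by
    rw [disc]
    linear_combination (-4 * a ^ 3 - 9 * b ^ 2) * h0 + 6 * a * b * h1 - 4 * a ^ 2 * h2
  have e1 : disc * c 1 = 0 := by
    rw [disc]
    linear_combination 6 * a * b * h0 + 2 * a ^ 2 * h1 + 9 * b * h2
  have e2 : disc * c 2 = 0 := by
    rw [disc]
    linear_combination (-4 * a ^ 2) * h0 + 9 * b * h1 - 6 * a * h2
  intro i
  fin_cases i
  · exact (mul_eq_zero.mp e0).resolve_left disc_ne_zero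
  · exact (mul_eq_zero.mp e1).resolve_left disc_ne_zero
  · exact (mul_eq_zero.mp e2).resolve_left disc_ne_zero

/-- Cramer's rule for the trace form, with the adjugate of its Gram matrix on `1, e, e ^ 2`. -/
lemma disc_smul_eq (x : R2) :
    disc • x =
      ((-4 * a ^ 3 - 9 * b ^ 2) * trace x + 6 * a * b * trace (x * e) -
        4 * a ^ 2 * trace (x * e ^ 2)) • (1 : R2) +
      (6 * a * b * trace x + 2 * a ^ 2 * trace (x * e) + 9 * b * trace (x * e ^ 2)) • e +
      (-4 * a ^ 2 * trace x + 9 * b * trace (x * e) - 6 * a * trace (x * e ^ 2)) • e ^ 2 := by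
  refine ext_evalAt fun τ t => ?_
  obtain ⟨h1, h2, h3⟩ := conjugates_e τ t
  simp only [smul_eq_incl_mul, disc]
  simp only [map_add, map_mul (evalAt _ τ t), evalAt_incl, evalAt_trace, map_sub, map_neg,
    map_pow, map_ofNat, map_one]
  rw [← h2, show evalAt 1 τ t b = -(evalAt 1 τ t e * evalAt S τ t e * evalAt (S * T) τ t e)
    by rw [h3, neg_neg]]
  have hz : evalAt (S * T) τ t e = -evalAt 1 τ t e - evalAt S τ t e := by
    linear_combination h1
  rw [hz]
  ring

lemma Δg_smul_eq_zero {x : R2} (h : Δg • x = 0) : x = 0 := by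
  refine eq_zero_of_evalAt fun τ t => ?_
  have := congrArg (evalAt 1 τ t) h
  rw [smul_eq_incl_mul, map_mul, map_zero, evalAt_incl] at this
  exact (mul_eq_zero.mp this).resolve_left (evalAt_Δg_ne_zero τ t)

/-- The coefficients in Cramer's rule vanish at the cusp, because two of the three conjugates of
`e` coincide there; so they are divisible by `Δ`, that is, by the discriminant. -/
lemma span_e : ⊤ ≤ Submodule.span R1 (Set.range fun i : Fin 3 => e ^ (i : ℕ)) := by
  rintro x -
  obtain ⟨c0, h0⟩ : Δg ∣ (-4 * a ^ 3 - 9 * b ^ 2) * trace x + 6 * a * b * trace (x * e) -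
      4 * a ^ 2 * trace (x * e ^ 2) := by
    refine Δg_dvd fun t => ?_
    simp only [map_add, map_mul, map_sub, map_neg, map_pow, map_ofNat, cuspVal_trace, cuspVal_a,
      cuspVal_b, cuspVal_one_e, cuspVal_S_e]
    ring
  obtain ⟨c1, h1⟩ : Δg ∣ 6 * a * b * trace x + 2 * a ^ 2 * trace (x * e) +
      9 * b * trace (x * e ^ 2) := by
    refine Δg_dvd fun t => ?_
    simp only [map_add, map_mul, map_pow, map_ofNat, cuspVal_trace, cuspVal_a,
      cuspVal_b, cuspVal_one_e, cuspVal_S_e]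
    ring
  obtain ⟨c2, h2⟩ : Δg ∣ -4 * a ^ 2 * trace x + 9 * b * trace (x * e) -
      6 * a * trace (x * e ^ 2) := by
    refine Δg_dvd fun t => ?_
    simp only [map_add, map_mul, map_sub, map_neg, map_pow, map_ofNat, cuspVal_trace, cuspVal_a,
      cuspVal_b, cuspVal_one_e, cuspVal_S_e]
    ring
  have h := disc_smul_eq x
  rw [h0, h1, h2, disc, disc_eq] at h
  have hx : x = (1 / 256 : ℂ) • (c0 • (1 : R2) + c1 • e + c2 • e ^ 2) := by
    rw [← sub_eq_zero]
    refine Δg_smul_eq_zero ?_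
    rw [smul_sub, smul_comm Δg (1 / 256 : ℂ), smul_add Δg, smul_add Δg, smul_smul,
      smul_smul, smul_smul, ← h, smul_assoc, smul_smul]
    norm_num
  have mem : ∀ i : Fin 3, e ^ (i : ℕ) ∈
      Submodule.span R1 (Set.range fun i : Fin 3 => e ^ (i : ℕ)) :=
    fun i => Submodule.subset_span ⟨i, rfl⟩
  have hs : ∀ y : R2, (1 / 256 : ℂ) • y = algebraMap ℂ R1 (1 / 256) • y := fun y =>
    (algebraMap_smul R1 _ y).symm
  rw [hx, hs]
  have m0 := mem 0
  have m1 := mem 1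
  have m2 := mem 2
  simp only [Fin.val_zero, Fin.val_one, Fin.val_two, pow_zero, pow_one] at m0 m1 m2
  exact Submodule.smul_mem _ _ (Submodule.add_mem _ (Submodule.add_mem _
    (Submodule.smul_mem _ _ m0) (Submodule.smul_mem _ _ m1)) (Submodule.smul_mem _ _ m2))

/-- The basis `1, e, e ^ 2` of the ring of forms on `Γ₀(2)` over the ring of full level. -/
noncomputable def basisE : Module.Basis (Fin 3) R1 R2 := Module.Basis.mk linearIndependent_e span_e

lemma basisE_apply (i : Fin 3) : basisE i = e ^ (i : ℕ) := Module.Basis.mk_apply _ _ i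

lemma leftMulMatrix_e :
    Algebra.leftMulMatrix basisE e = !![0, 0, -b; 1, 0, -a; 0, 1, 0] := by
  have h0 : e * basisE 0 = basisE 1 := by simp [basisE_apply]
  have h1 : e * basisE 1 = basisE 2 := by
    simp only [basisE_apply, Fin.val_one, Fin.val_two]
    ring
  have h2 : e * basisE 2 = (-b) • basisE 0 + (-a) • basisE 1 := by
    simp only [basisE_apply, Fin.val_zero, Fin.val_one, Fin.val_two, smul_eq_incl_mul, map_neg]
    linear_combination e_cube
  ext i j
  rw [Algebra.leftMulMatrix_eq_repr_mul]
  fin_cases j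
  · rw [Fin.zero_eta, h0]
    fin_cases i <;> simp
  · rw [Fin.mk_one, h1]
    fin_cases i <;> simp
  · rw [show (⟨2, by decide⟩ : Fin 3) = 2 from rfl, h2]
    fin_cases i <;> simp

lemma trace_leftMulMatrix (x : R2) : (Algebra.leftMulMatrix basisE x).trace = trace x := by
  have h : (Matrix.traceLinearMap (Fin 3) R1 R1).comp
      (Algebra.leftMulMatrix basisE).toLinearMap = trace := by
    refine basisE.ext fun i => ?_
    rw [basisE_apply, LinearMap.comp_apply, AlgHom.toLinearMap_apply, map_pow, leftMulMatrix_e,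
      Matrix.traceLinearMap_apply]
    fin_cases i
    · simp [trace_one]
    · simp [trace_e, Matrix.trace_fin_three]
    · simp only
      rw [trace_e_sq, sq, Matrix.trace_fin_three]
      simp [Matrix.mul_apply, Fin.sum_univ_three]
      ring
  exact LinearMap.congr_fun h x

/-! ### The map `f ↦ f'` and the Hecke operator -/

lemma primeMap_of {k : ℤ} (f : ModularForm 𝒮ℒ k) :
    primeMap (DirectSum.of (ModularForm 𝒮ℒ) k f) =
      DirectSum.of (ModularForm G02) k (primeForm f) := by
  rw [primeMap, ← DirectSum.lof_eq_of ℂ, DirectSum.toModule_lof]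
  rfl

lemma IsHom.primeMap {k : ℤ} {x : R1} (hx : IsHom k x) : IsHom k (HeckeGen.primeMap x) := by
  obtain ⟨f, rfl⟩ := hx
  exact ⟨_, primeMap_of f⟩

/-- The unit `2` of `ℂ`: on the evaluation parameter, it accounts for the factor `2 ^ k` in
`f'(τ) = 2 ^ k f(2τ)`. -/
noncomputable def twoUnit : ℂˣ := Units.mk0 2 two_ne_zero

lemma evalAt_primeMap (τ : ℍ) (t : ℂˣ) (x : R1) :
    evalAt 1 τ t (primeMap x) = evalAt 1 (dbl τ) (twoUnit * t) x := by
  induction x using DirectSum.induction_on with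
  | zero => simp
  | of k f =>
    rw [primeMap_of, evalAt_one_of, evalAt_one_of, Units.val_mul, mul_zpow, twoUnit, Units.val_mk0]
    change (2 : ℂ) ^ k * f (dbl τ) * (t : ℂ) ^ k = _
    ring
  | add x y hx hy => rw [map_add, map_add, map_add, hx, hy]

lemma primeForm_slash_S {k : ℤ} (f : ModularForm 𝒮ℒ k) :
    (primeForm f : ℍ → ℂ) ∣[k] S = (2 : ℂ) • ((f : ℍ → ℂ) ∣[k] gH 0) := by
  have hf : ∀ γ : SL(2, ℤ), (f : ℍ → ℂ) ∣[k] (mapGL ℝ γ) = f := fun γ =>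
    f.slash_action_eq' _ ⟨γ, rfl⟩
  change (fun τ => (2 : ℂ) ^ k * f (dbl τ)) ∣[k] S = _
  rw [primeFun_eq, SL_smul_slash, slash_mul_of_eq hf gD (gH 0) _ S]
  apply ups_mul <;> simp [ModularGroup.S]

lemma primeForm_slash_ST {k : ℤ} (f : ModularForm 𝒮ℒ k) :
    (primeForm f : ℍ → ℂ) ∣[k] (S * T) = (2 : ℂ) • ((f : ℍ → ℂ) ∣[k] gH 1) := by
  have hf : ∀ γ : SL(2, ℤ), (f : ℍ → ℂ) ∣[k] (mapGL ℝ γ) = f := fun γ =>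
    f.slash_action_eq' _ ⟨γ, rfl⟩
  rw [SlashAction.slash_mul, primeForm_slash_S, SL_smul_slash,
    slash_mul_of_eq hf (gH 0) (gH 1) _ 1]
  apply ups_mul <;> simp [ModularGroup.T]

lemma evalAt_S_primeMap (τ : ℍ) (t : ℂˣ) (x : R1) :
    evalAt S τ t (primeMap x) = evalAt 1 (halve 0 τ) t x := by
  induction x using DirectSum.induction_on with
  | zero => simp
  | of k f =>
    rw [primeMap_of, evalAt_of, evalAt_one_of, primeForm_slash_S, Pi.smul_apply, slash_gH,
      smul_eq_mul]
    ring
  | add x y hx hy => rw [map_add, map_add, map_add, hx, hy]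

lemma evalAt_ST_primeMap (τ : ℍ) (t : ℂˣ) (x : R1) :
    evalAt (S * T) τ t (primeMap x) = evalAt 1 (halve 1 τ) t x := by
  induction x using DirectSum.induction_on with
  | zero => simp
  | of k f =>
    rw [primeMap_of, evalAt_of, evalAt_one_of, primeForm_slash_ST, Pi.smul_apply, slash_gH,
      smul_eq_mul]
    ring
  | add x y hx hy => rw [map_add, map_add, map_add, hx, hy]

lemma cuspVal_primeMap (t : ℂˣ) (x : R1) :
    cuspVal 1 t (primeMap x) = cuspVal 1 (twoUnit * t) x := by
  refine tendsto_nhds_unique (tendsto_evalAt 1 t (primeMap x)) ?_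
  simp only [evalAt_primeMap]
  exact (tendsto_evalAt 1 (twoUnit * t) x).comp tendsto_dbl

lemma cuspVal_S_primeMap (t : ℂˣ) (x : R1) : cuspVal S t (primeMap x) = cuspVal 1 t x := by
  refine tendsto_nhds_unique (tendsto_evalAt S t (primeMap x)) ?_
  simp only [evalAt_S_primeMap]
  exact (tendsto_evalAt 1 t x).comp (tendsto_halve 0)

lemma primeMap_mul (x y : R1) : primeMap (x * y) = primeMap x * primeMap y :=
  ext_evalAt fun τ t => by simp only [map_mul (evalAt _ _ _), evalAt_primeMap]

lemma primeMap_one : primeMap 1 = 1 :=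
  ext_evalAt fun τ t => by rw [evalAt_primeMap, map_one, map_one]

lemma primeMap_pow (x : R1) (n : ℕ) : primeMap (x ^ n) = primeMap x ^ n := by
  induction n with
  | zero => rw [pow_zero, pow_zero, primeMap_one]
  | succ n ih => rw [pow_succ, pow_succ, primeMap_mul, ih]

lemma T2_of {k : ℤ} (f : ModularForm 𝒮ℒ k) :
    T2 (DirectSum.of (ModularForm 𝒮ℒ) k f) =
      DirectSum.of (ModularForm 𝒮ℒ) k (heckeForm f) := by
  rw [T2, ← DirectSum.lof_eq_of ℂ, DirectSum.toModule_lof]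
  rfl

lemma evalAt_T2 (τ : ℍ) (t : ℂˣ) (x : R1) :
    evalAt 1 τ t (T2 x) = 1 / 2 * (evalAt 1 (dbl τ) (twoUnit * t) x +
      evalAt 1 (halve 0 τ) t x + evalAt 1 (halve 1 τ) t x) := by
  induction x using DirectSum.induction_on with
  | zero => simp
  | of k f =>
    rw [T2_of, evalAt_one_of, evalAt_one_of, evalAt_one_of, evalAt_one_of, Units.val_mul,
      mul_zpow, twoUnit, Units.val_mk0]
    change (1 / 2 : ℂ) * ((2 : ℂ) ^ k * f (dbl τ) + ∑ n ∈ Finset.range 2, f (halve n τ)) *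
      (t : ℂ) ^ k = _
    rw [Finset.sum_range_succ, Finset.sum_range_one]
    ring
  | add x y hx hy =>
    rw [map_add, map_add, map_add, map_add, map_add, hx, hy]
    ring

/-- The Hecke operator is half the trace of `f'`. -/
lemma T2_eq_trace (x : R1) : T2 x = (1 / 2 : ℂ) • trace (primeMap x) :=
  ext_evalAt fun τ t => by
    rw [evalAt_T2, map_smul, evalAt_trace, evalAt_primeMap, evalAt_S_primeMap,
      evalAt_ST_primeMap, smul_eq_mul]

/-- A homogeneous element of weight less than `8` on `Γ₀(2)` that vanishes at both cusps is
zero: its products with `1`, `e`, `e ^ 2` have traces of weight less than `12` that vanish at the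
cusp. -/
lemma IsHom.eq_zero_of_cuspVal_two {k : ℤ} {x : R2} (hx : IsHom k x) (hk : k < 8)
    (h1 : cuspVal 1 1 x = 0) (hS : cuspVal S 1 x = 0) : x = 0 := by
  refine eq_zero_of_trace (hx.trace.eq_zero_of_cuspVal (by omega) ?_)
    ((hx.mul isHom_e).trace.eq_zero_of_cuspVal (by omega) ?_)
    ((hx.mul (isHom_e.pow 2)).trace.eq_zero_of_cuspVal (by push_cast; omega) ?_) <;>
  simp [cuspVal_trace, h1, hS]

lemma primeMap_a : primeMap a = -15 * e ^ 2 - 4 * incl a := by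
  rw [← sub_eq_zero]
  have h : IsHom 4 (primeMap a + (15 : ℂ) • e ^ 2 + (4 : ℂ) • incl a) :=
    (isHom_a.primeMap.add ((isHom_e.pow 2).smul 15)).add (isHom_a.incl.smul 4)
  have h' := h.eq_zero_of_cuspVal_two (by norm_num)
    (by
      simp only [map_add, map_smul, map_pow, cuspVal_primeMap, cuspVal_one_e, cuspVal_incl,
        cuspVal_a, twoUnit, Units.val_mul, Units.val_mk0, Units.val_one, smul_eq_mul]
      norm_num)
    (by
      simp only [map_add, map_smul, map_pow, cuspVal_S_primeMap, cuspVal_S_e, cuspVal_incl,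
        cuspVal_a, Units.val_one, smul_eq_mul]
      norm_num)
  rw [← h', Algebra.smul_def, Algebra.smul_def, map_ofNat, map_ofNat]
  ring

lemma primeMap_b : primeMap b = 22 * incl b + 14 * incl a * e := by
  rw [← sub_eq_zero]
  have h : IsHom 6 (primeMap b + (-22 : ℂ) • incl b + (-14 : ℂ) • (incl a * e)) :=
    (isHom_b.primeMap.add (isHom_b.incl.smul (-22))).add ((isHom_a.incl.mul isHom_e).smul (-14))
  have h' := h.eq_zero_of_cuspVal_two (by norm_num)
    (by
      simp only [map_add, map_smul, map_mul, cuspVal_primeMap, cuspVal_one_e, cuspVal_incl,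
        cuspVal_a, cuspVal_b, twoUnit, Units.val_mul, Units.val_mk0, Units.val_one, smul_eq_mul]
      norm_num)
    (by
      simp only [map_add, map_smul, map_mul, cuspVal_S_primeMap, cuspVal_S_e, cuspVal_incl,
        cuspVal_a, cuspVal_b, Units.val_one, smul_eq_mul]
      norm_num)
  rw [← h', Algebra.smul_def, Algebra.smul_def, map_neg, map_neg, map_ofNat, map_ofNat]
  ring

end HeckeGen

/-! ### The generating function as a trace -/

namespace HeckeGen

section GeometricSeries

variable {R : Type*} [CommRing R] {m : Type*} [Fintype m]

lemma coeff_X_mul_eq_ite {σ : Type*} [DecidableEq σ] (s : σ) (n : σ →₀ ℕ)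
    (φ : MvPowerSeries σ R) :
    MvPowerSeries.coeff n (MvPowerSeries.X s * φ) =
      if n s = 0 then 0 else MvPowerSeries.coeff (n - Finsupp.single s 1) φ := by
  rw [MvPowerSeries.X_def, MvPowerSeries.coeff_monomial_mul, one_mul]
  simp only [Finsupp.single_le_iff]
  split_ifs <;> first | rfl | omega

/-- The matrix of power series `∑ X₀ ^ i X₁ ^ j P ^ i Q ^ j`. -/
def geomSeries [DecidableEq m] (P Q : Matrix m m R) : Matrix m m (MvPowerSeries (Fin 2) R) :=
  Matrix.of fun i j n => (P ^ n 0 * Q ^ n 1) i j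

lemma coeff_geomSeries [DecidableEq m] (P Q : Matrix m m R) (i j : m) (n : Fin 2 →₀ ℕ) :
    MvPowerSeries.coeff n (geomSeries P Q i j) = (P ^ n 0 * Q ^ n 1) i j := rfl

lemma coeff_smul_map_C_mul (s : Fin 2) (P : Matrix m m R)
    (M : Matrix m m (MvPowerSeries (Fin 2) R)) (i j : m) (n : Fin 2 →₀ ℕ) :
    MvPowerSeries.coeff n
        (((MvPowerSeries.X s : MvPowerSeries (Fin 2) R) • P.map MvPowerSeries.C * M :
          Matrix m m (MvPowerSeries (Fin 2) R)) i j) =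
      if n s = 0 then 0 else
        ∑ k, P i k * MvPowerSeries.coeff (n - Finsupp.single s 1) (M k j) := by
  rw [Matrix.smul_mul, Matrix.smul_apply, smul_eq_mul, coeff_X_mul_eq_ite, Matrix.mul_apply,
    map_sum]
  simp only [Matrix.map_apply, MvPowerSeries.coeff_C_mul]

/-- The geometric series in two commuting matrices is the inverse of
`(1 - X₀ P) (1 - X₁ Q)`. -/
lemma mul_geomSeries [DecidableEq m] {P Q : Matrix m m R} (h : Commute P Q) :
    ((1 - (MvPowerSeries.X 0 : MvPowerSeries (Fin 2) R) • P.map MvPowerSeries.C) *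
      (1 - (MvPowerSeries.X 1 : MvPowerSeries (Fin 2) R) • Q.map MvPowerSeries.C)) *
        geomSeries P Q = 1 := by
  -- `K` collects the terms without `X₁`.
  set K : Matrix m m (MvPowerSeries (Fin 2) R) :=
    Matrix.of fun i j n => if n 1 = 0 then (P ^ n 0) i j else 0 with hK
  have hKc : ∀ i j n, MvPowerSeries.coeff n (K i j) = if n 1 = 0 then (P ^ n 0) i j else 0 :=
    fun _ _ _ => rfl
  have h1 : (1 - (MvPowerSeries.X 1 : MvPowerSeries (Fin 2) R) • Q.map MvPowerSeries.C) *
      geomSeries P Q = K := by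
    ext1 i j
    refine MvPowerSeries.ext fun n => ?_
    rw [sub_mul, one_mul, Matrix.sub_apply, map_sub, coeff_smul_map_C_mul, hKc, coeff_geomSeries]
    by_cases hn : n 1 = 0
    · rw [if_pos hn, if_pos hn, hn, pow_zero, mul_one, sub_zero]
    · rw [if_neg hn, if_neg hn, sub_eq_zero]
      obtain ⟨l, hl⟩ := Nat.exists_eq_succ_of_ne_zero hn
      simp only [coeff_geomSeries, Finsupp.tsub_apply]
      rw [← Matrix.mul_apply, Finsupp.single_eq_same, Finsupp.single_eq_of_ne (by decide), hl,
        Nat.sub_zero, Nat.succ_sub_one, ← mul_assoc, (h.pow_left (n 0)).symm.eq, pow_succ',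
        mul_assoc]
  have h0 : (1 - (MvPowerSeries.X 0 : MvPowerSeries (Fin 2) R) • P.map MvPowerSeries.C) * K =
      1 := by
    ext1 i j
    refine MvPowerSeries.ext fun n => ?_
    rw [sub_mul, one_mul, Matrix.sub_apply, map_sub, coeff_smul_map_C_mul, hKc]
    have hone : MvPowerSeries.coeff n ((1 : Matrix m m (MvPowerSeries (Fin 2) R)) i j) =
        if n 0 = 0 ∧ n 1 = 0 then (1 : Matrix m m R) i j else 0 := by
      have hn : n = 0 ↔ n 0 = 0 ∧ n 1 = 0 := by
        rw [DFunLike.ext_iff, Fin.forall_fin_two]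
        rfl
      by_cases hij : i = j
      · subst hij
        rw [Matrix.one_apply_eq, Matrix.one_apply_eq, MvPowerSeries.coeff_one]
        simp only [hn]
      · simp [Matrix.one_apply_ne hij]
    rw [hone]
    have h10 : (Finsupp.single (0 : Fin 2) 1 : Fin 2 →₀ ℕ) 1 = 0 :=
      Finsupp.single_eq_of_ne (by decide)
    simp only [hKc, Finsupp.tsub_apply, Finsupp.single_eq_same, h10, Nat.sub_zero]
    by_cases hn1 : n 1 = 0
    · simp only [hn1, if_true, and_true]
      by_cases hn0 : n 0 = 0
      · rw [if_pos hn0, if_pos hn0, hn0, pow_zero, sub_zero]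
      · obtain ⟨l, hl⟩ := Nat.exists_eq_succ_of_ne_zero hn0
        rw [if_neg hn0, if_neg hn0, ← Matrix.mul_apply, hl, Nat.succ_sub_one, ← pow_succ',
          sub_self]
    · simp [hn1]
  rw [mul_assoc, h1, h0]

end GeometricSeries

lemma leftMulMatrix_primeMap_a :
    Algebra.leftMulMatrix basisE (primeMap a) =
      !![-4 * a, 15 * b, 0; 0, 11 * a, 15 * b; -15, 0, 11 * a] := by
  have h : primeMap a = (-15 : R1) • e ^ 2 - (4 * a) • (1 : R2) := by
    rw [primeMap_a, smul_eq_incl_mul, smul_eq_incl_mul]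
    simp only [map_neg, map_mul, map_ofNat]
    ring
  rw [h, map_sub, map_smul, map_smul, map_one, map_pow, leftMulMatrix_e, sq]
  ext1 i j
  fin_cases i <;> fin_cases j <;> simp <;> ring

lemma leftMulMatrix_primeMap_b :
    Algebra.leftMulMatrix basisE (primeMap b) =
      !![22 * b, 0, -14 * a * b; 14 * a, 22 * b, -14 * a ^ 2; 0, 14 * a, 22 * b] := by
  have h : primeMap b = (22 * b) • (1 : R2) + (14 * a) • e := by
    rw [primeMap_b, smul_eq_incl_mul, smul_eq_incl_mul]
    simp only [map_mul, map_ofNat]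
    ring
  rw [h, map_add, map_smul, map_smul, map_one, leftMulMatrix_e]
  ext1 i j
  fin_cases i <;> fin_cases j <;> simp
  ring

lemma matM_eq :
    matM (cst a) (cst b) A B =
      (1 - A • (Algebra.leftMulMatrix basisE (primeMap a)).map cst) *
        (1 - B • (Algebra.leftMulMatrix basisE (primeMap b)).map cst) := by
  rw [leftMulMatrix_primeMap_a, leftMulMatrix_primeMap_b, matM]
  have h4 : cst 4 = 4 := map_ofNat cst 4
  have h11 : cst 11 = 11 := map_ofNat cst 11
  have h14 : cst 14 = 14 := map_ofNat cst 14
  have h15 : cst 15 = 15 := map_ofNat cst 15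
  have h22 : cst 22 = 22 := map_ofNat cst 22
  congr 1
  · ext1 i j
    fin_cases i <;> fin_cases j <;> simp [h4, h11, h15] <;> ring
  · ext1 i j
    fin_cases i <;> fin_cases j <;> simp [h14, h22] <;> ring

lemma mul_geomSeries_leftMulMatrix :
    ((1 - A • (Algebra.leftMulMatrix basisE (primeMap a)).map cst) *
        (1 - B • (Algebra.leftMulMatrix basisE (primeMap b)).map cst)) *
      geomSeries (Algebra.leftMulMatrix basisE (primeMap a))
        (Algebra.leftMulMatrix basisE (primeMap b)) = 1 :=
  mul_geomSeries ((Commute.all (primeMap a) (primeMap b)).map (Algebra.leftMulMatrix basisE))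

lemma F2_eq_trace_geomSeries :
    F2 = (1 / 2 : ℂ) • (geomSeries (Algebra.leftMulMatrix basisE (primeMap a))
      (Algebra.leftMulMatrix basisE (primeMap b))).trace := by
  refine MvPowerSeries.ext fun n => ?_
  have h : MvPowerSeries.coeff n (geomSeries (Algebra.leftMulMatrix basisE (primeMap a))
      (Algebra.leftMulMatrix basisE (primeMap b))).trace =
        trace (primeMap (a ^ n 0 * b ^ n 1)) := by
    rw [Matrix.trace, map_sum, primeMap_mul, primeMap_pow, primeMap_pow, ← trace_leftMulMatrix,
      map_mul, map_pow, map_pow]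
    rfl
  have hsmul : ∀ φ : Ser, MvPowerSeries.coeff n ((1 / 2 : ℂ) • φ) =
      (1 / 2 : ℂ) • MvPowerSeries.coeff n φ := fun _ => rfl
  rw [hsmul, h, ← T2_eq_trace]
  rfl

/-! ### Rationality of the generating function -/

section Specialization

open MvPolynomial

variable {σ k : Type*} [DecidableEq σ]

/-- Substitution of the constant `c` for the indeterminate `v`. -/
noncomputable def specialize [CommRing k] (v : σ) (c : k) :
    MvPolynomial σ k →ₐ[k] MvPolynomial σ k :=
  bind₁ (Function.update X v (C c))

@[simp] lemma specialize_X [CommRing k] (v : σ) (c : k) (w : σ) :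
    specialize v c (X w) = if w = v then C c else X w := by
  rw [specialize, bind₁_X_right, Function.update_apply]

lemma notMem_vars_of_specialize_eq [CommRing k] [Nontrivial k] {v : σ} {q : MvPolynomial σ k}
    (h : specialize v 0 q = q) : v ∉ q.vars := by
  intro hv
  rw [← h] at hv
  obtain ⟨w, -, hw⟩ := Finset.mem_biUnion.1 (vars_bind₁ _ q hv)
  rcases eq_or_ne w v with rfl | hne
  · simp at hw
  · rw [Function.update_of_ne hne] at hw
    have := (degreeOf_X (R := k) v w)
    rw [if_neg hne.symm, degreeOf_def, Multiset.count_eq_zero] at this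
    exact this (Multiset.mem_toFinset.1 (vars_def (X w : MvPolynomial σ k) ▸ hw))

/-- A divisor of a nonzero polynomial that does not involve `v` does not involve `v` either, so
divisibility by it survives any substitution for `v`. -/
lemma dvd_specialize [CommRing k] [IsDomain k] {v : σ} {d q s : MvPolynomial σ k} (hq : q ≠ 0)
    (hqv : specialize v 0 q = q) (hdq : d ∣ q) (hds : d ∣ s) (c : k) : d ∣ specialize v c s := by
  have hd : v ∉ d.vars := by
    obtain ⟨r, rfl⟩ := hdq
    have h0 := notMem_vars_of_specialize_eq hqv
    have hdeg := degreeOf_mul_eq (n := v) (left_ne_zero_of_mul hq) (right_ne_zero_of_mul hq)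
    rw [vars_def, Multiset.mem_toFinset, ← Multiset.count_eq_zero, ← degreeOf_def] at h0
    rw [vars_def, Multiset.mem_toFinset, ← Multiset.count_eq_zero, ← degreeOf_def]
    omega
  have hfix : specialize v c d = d := by
    refine (hom_congr_vars (f₁ := (specialize v c).toRingHom) (f₂ := RingHom.id _) ?_ ?_
      (rfl : d = d))
    · ext x
      simp
    · intro w hw _
      have hne : w ≠ v := fun h => hd (h ▸ hw)
      simp [hne]
  rw [← hfix]
  exact map_dvd _ hds

end Specialization

section Cubic

variable {K : Type*} [CommRing K]

lemma det_matM (x y X Y : K) :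
    (matM x y X Y).det =
      ((1 + 4 * X * x) * (1 - 11 * X * x) ^ 2 + 3375 * X ^ 3 * y ^ 2) *
        ((1 - 22 * Y * y) ^ 3 + 196 * Y ^ 2 * x ^ 3 * (1 - 8 * Y * y)) := by
  rw [matM, Matrix.det_mul, Matrix.det_fin_three, Matrix.det_fin_three]
  simp
  ring

lemma trace_adjugate_matM_zero_right (x y X : K) :
    (matM x y X 0).adjugate.trace = 3 * (1 - 11 * X * x) * (1 - X * x) := by
  rw [matM, Matrix.adjugate_mul_distrib, Matrix.adjugate_fin_three_of,
    Matrix.adjugate_fin_three_of]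
  simp [Matrix.trace_fin_three]
  ring

lemma trace_adjugate_matM_zero_left (x y Y : K) :
    (matM x y 0 Y).adjugate.trace = 3 * (1 - 22 * Y * y) ^ 2 + 196 * Y ^ 2 * x ^ 3 := by
  rw [matM, Matrix.adjugate_mul_distrib, Matrix.adjugate_fin_three_of,
    Matrix.adjugate_fin_three_of]
  simp [Matrix.trace_fin_three]
  ring

lemma map_matM {L : Type*} [CommRing L] (f : K →+* L) (x y X Y : K) :
    (matM x y X Y).map f = matM (f x) (f y) (f X) (f Y) := by
  rw [matM, Matrix.map_mul, matM]
  congr 1 <;> ext1 i j <;> fin_cases i <;> fin_cases j <;> simp [map_ofNat]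

end Cubic

section Coprime

open MvPolynomial

lemma specialize_trace_adjugate (v : Fin 4) (c : ℚ) :
    specialize v c (matM (X 0) (X 1) (X 2) (X 3)).adjugate.trace =
      (matM (specialize v c (X 0)) (specialize v c (X 1)) (specialize v c (X 2))
        (specialize v c (X 3))).adjugate.trace := by
  rw [AddMonoidHom.map_trace]
  exact congrArg Matrix.trace (((specialize v c).map_adjugate _).trans
    (congrArg Matrix.adjugate (map_matM (specialize v c).toRingHom _ _ _ _)))

lemma isRelPrime_trace_adjugate_left :
    IsRelPrime (matM (X 0) (X 1) (X 2) (X 3) : Matrix _ _ (MvPolynomial (Fin 4) ℚ)).adjugate.trace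
      ((1 + 4 * X 2 * X 0) * (1 - 11 * X 2 * X 0) ^ 2 + 3375 * X 2 ^ 3 * X 1 ^ 2) := by
  intro d hP hd
  -- `d` does not involve `B`, so it divides the numerator at `B = 0`.
  have h0 := dvd_specialize (v := (3 : Fin 4))
    (fun h => by simpa [map_ofNat] using congrArg (eval 0) h) (by simp [map_ofNat]) hd hP 0
  rw [specialize_trace_adjugate] at h0
  simp only [specialize_X, C_0, if_true, Fin.reduceEq, if_false,
    trace_adjugate_matM_zero_right] at h0
  -- That value does not involve `b`, so `b` may be specialized to `0` and `1`.
  have hb := dvd_specialize (v := (1 : Fin 4)) (d := d)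
    (fun h => by simpa [map_ofNat] using congrArg (eval 0) h) (by simp [map_ofNat]) h0 hd
  have h1 := hb 0
  have h2 := hb 1
  simp only [map_add, map_mul, map_sub, map_pow, map_one, map_ofNat, specialize_X, C_0,
    if_true, Fin.reduceEq, if_false] at h1 h2
  have h3 := dvd_sub h2 h1
  have h4 : d ∣ (X 2 : MvPolynomial (Fin 4) ℚ) ^ 3 := by
    refine (h3.mul_left (C (1 / 3375))).trans (dvd_of_eq ?_)
    have hC : (C (1 / 3375) : MvPolynomial (Fin 4) ℚ) * 3375 = 1 := by
      rw [← map_ofNat (C : ℚ →+* MvPolynomial (Fin 4) ℚ), ← C_mul, ← C_1]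
      norm_num
    linear_combination X 2 ^ 3 * hC
  have hx : IsCoprime (1 + 4 * X 2 * X 0 : MvPolynomial (Fin 4) ℚ) (X 2) :=
    ⟨1, -4 * X 0, by ring⟩
  have hy : IsCoprime (1 - 11 * X 2 * X 0 : MvPolynomial (Fin 4) ℚ) (X 2) :=
    ⟨1, 11 * X 0, by ring⟩
  refine ((hx.mul_left (hy.pow_left (m := 2))).pow_right (n := 3)).isUnit_of_dvd' ?_ h4
  simpa using h1

lemma isRelPrime_trace_adjugate_right :
    IsRelPrime (matM (X 0) (X 1) (X 2) (X 3) : Matrix _ _ (MvPolynomial (Fin 4) ℚ)).adjugate.trace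
      ((1 - 22 * X 3 * X 1) ^ 3 + 196 * X 3 ^ 2 * X 0 ^ 3 * (1 - 8 * X 3 * X 1)) := by
  intro d hP hd
  -- `d` does not involve `A`, so it divides the numerator at `A = 0`.
  have h0 := dvd_specialize (v := (2 : Fin 4))
    (fun h => by simpa [map_ofNat] using congrArg (eval 0) h) (by simp [map_ofNat]) hd hP 0
  rw [specialize_trace_adjugate] at h0
  simp only [specialize_X, C_0, if_true, Fin.reduceEq, if_false,
    trace_adjugate_matM_zero_left] at h0
  -- Eliminating `a` gives a multiple of `d` that does not involve `a`.
  have h1 : d ∣ 2 * (1 - 22 * X 3 * X 1) ^ 2 * (1 - X 3 * X 1) := by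
    refine ((h0.mul_left (1 - 8 * X 3 * X 1)).sub hd).trans (dvd_of_eq ?_)
    ring
  have ha := dvd_specialize (v := (0 : Fin 4)) (d := d)
    (fun h => by simpa [map_ofNat] using congrArg (eval 0) h) (by simp [map_ofNat]) h1 h0
  have h2 := ha 0
  have h3 := ha 1
  simp only [map_add, map_mul, map_sub, map_pow, map_one, map_ofNat, specialize_X, C_0,
    if_true, Fin.reduceEq, if_false] at h2 h3
  have h4 : d ∣ (X 3 : MvPolynomial (Fin 4) ℚ) ^ 2 := by
    refine ((dvd_sub h3 h2).mul_left (C (1 / 196))).trans (dvd_of_eq ?_)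
    have hC : (C (1 / 196) : MvPolynomial (Fin 4) ℚ) * 196 = 1 := by
      rw [← map_ofNat (C : ℚ →+* MvPolynomial (Fin 4) ℚ), ← C_mul, ← C_1]
      norm_num
    linear_combination X 3 ^ 2 * hC
  have h5 : d ∣ (1 - 22 * X 3 * X 1 : MvPolynomial (Fin 4) ℚ) ^ 2 := by
    refine (h2.mul_left (C (1 / 3))).trans (dvd_of_eq ?_)
    have hC : (C (1 / 3) : MvPolynomial (Fin 4) ℚ) * 3 = 1 := by
      rw [← map_ofNat (C : ℚ →+* MvPolynomial (Fin 4) ℚ), ← C_mul, ← C_1]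
      norm_num
    linear_combination (1 - 22 * X 3 * X 1) ^ 2 * hC
  have hu : IsCoprime (1 - 22 * X 3 * X 1 : MvPolynomial (Fin 4) ℚ) (X 3) :=
    ⟨1, 22 * X 1, by ring⟩
  exact (hu.pow (m := 2) (n := 2)).isUnit_of_dvd' h5 h4

end Coprime

open MvPolynomial in
lemma toSer_eq_aeval (p : MvPolynomial (Fin 4) ℚ) :
    toSer p = aeval ![cst a, cst b, A, B] (map (algebraMap ℚ ℂ) p) := by
  rw [aeval_def, eval₂_map]
  rfl

open MvPolynomial in
lemma toSer_injective : Function.Injective toSer := by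
  have hy : AlgebraicIndependent R1 ![A, B] := by
    have : ∀ p : MvPolynomial (Fin 2) R1, aeval ![A, B] p = (p : Ser) := by
      intro p
      change _ = coeToMvPowerSeries.ringHom p
      induction p using MvPolynomial.induction_on with
      | C c => simp [MvPowerSeries.algebraMap_apply]
      | add p q hp hq => rw [map_add, map_add, hp, hq]
      | mul_X p i hp =>
        rw [map_mul, map_mul, hp]
        fin_cases i <;> simp [A, B]
    intro p q h
    change aeval _ p = aeval _ q at h
    rw [this, this] at h
    exact MvPolynomial.coe_injective _ _ h
  have hx : AlgebraicIndependent ℂ ![a, b] := aeval_injective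
  have hxy := (AlgebraicIndependent.sumElim_comp hx hy).comp
    ![Sum.inr 0, Sum.inr 1, Sum.inl 0, Sum.inl 1] (by decide)
  have hfun : (Sum.elim ![A, B] (algebraMap R1 Ser ∘ ![a, b]) ∘
      ![Sum.inr 0, Sum.inr 1, Sum.inl 0, Sum.inl 1] : Fin 4 → Ser) = ![cst a, cst b, A, B] := by
    ext1 i
    fin_cases i <;> rfl
  rw [hfun] at hxy
  intro p q h
  rw [toSer_eq_aeval, toSer_eq_aeval] at h
  exact map_injective _ (algebraMap ℚ ℂ).injective (hxy h)

lemma toSer_C (q : ℚ) : toSer (MvPolynomial.C q) = algebraMap ℂ Ser (q : ℂ) := by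
  simp [toSer]

lemma map_matM_toSer :
    (matM (MvPolynomial.X 0) (MvPolynomial.X 1) (MvPolynomial.X 2) (MvPolynomial.X 3)).map toSer =
      matM (cst a) (cst b) A B := by
  rw [map_matM]
  simp [toSer]

lemma toSer_detM : toSer detM = (matM (cst a) (cst b) A B).det := by
  rw [detM, RingHom.map_det]
  exact congrArg Matrix.det map_matM_toSer

lemma toSer_trace_adjugate :
    toSer (matM (MvPolynomial.X 0) (MvPolynomial.X 1) (MvPolynomial.X 2)
      (MvPolynomial.X 3)).adjugate.trace = (matM (cst a) (cst b) A B).adjugate.trace := by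
  rw [AddMonoidHom.map_trace]
  exact congrArg Matrix.trace ((toSer.map_adjugate _).trans
    (congrArg Matrix.adjugate map_matM_toSer))

lemma matM_mul_geomSeries :
    matM (cst a) (cst b) A B *
      geomSeries (Algebra.leftMulMatrix basisE (primeMap a))
        (Algebra.leftMulMatrix basisE (primeMap b)) = 1 := by
  rw [matM_eq, mul_geomSeries_leftMulMatrix]

lemma F2_eq_trace_inv : F2 = (1 / 2 : ℂ) • ((matM (cst a) (cst b) A B)⁻¹).trace := by
  rw [Matrix.inv_eq_right_inv matM_mul_geomSeries, F2_eq_trace_geomSeries]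

lemma isUnit_matM : IsUnit (matM (cst a) (cst b) A B) :=
  .of_mul_eq_one _ matM_mul_geomSeries

lemma isRelPrime_trace_adjugate_detM :
    IsRelPrime (matM (MvPolynomial.X 0) (MvPolynomial.X 1) (MvPolynomial.X 2)
      (MvPolynomial.X 3)).adjugate.trace detM := by
  rw [detM, det_matM]
  exact isRelPrime_trace_adjugate_left.mul_right isRelPrime_trace_adjugate_right

/-- The numerator of the generating function over `det M` is half the trace of the adjugate. -/
lemma F2_mul_toSer_detM :
    F2 * toSer detM = toSer (MvPolynomial.C (1 / 2) * (matM (MvPolynomial.X 0) (MvPolynomial.X 1)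
      (MvPolynomial.X 2) (MvPolynomial.X 3)).adjugate.trace) := by
  have hdet : IsUnit (matM (cst a) (cst b) A B).det :=
    (Matrix.isUnit_iff_isUnit_det _).1 isUnit_matM
  rw [map_mul, toSer_trace_adjugate, toSer_C, toSer_detM, F2_eq_trace_inv, Matrix.inv_def,
    Matrix.trace_smul, smul_eq_mul, Algebra.smul_def, mul_assoc, mul_right_comm,
    Ring.inverse_mul_cancel _ hdet, one_mul]
  norm_num


end HeckeGen

theorem theorem3p4 :
    -- the graded ring of full level is the polynomial ring `ℂ[a, b]`
    Function.Bijective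
      (MvPolynomial.aeval ![HeckeGen.a, HeckeGen.b] :
        MvPolynomial (Fin 2) ℂ →ₐ[ℂ] HeckeGen.R1) ∧
    -- the first formula, through the regular representation in the basis `1, e, e ^ 2`
    (∃ β : Module.Basis (Fin 3) HeckeGen.R1 HeckeGen.R2,
      (∀ i : Fin 3, β i = HeckeGen.e ^ (i : ℕ)) ∧
      Algebra.leftMulMatrix β HeckeGen.e =
        !![0, 0, -HeckeGen.b; 1, 0, -HeckeGen.a; 0, 1, 0] ∧
      IsUnit ((1 - HeckeGen.A •
            (Algebra.leftMulMatrix β (HeckeGen.primeMap HeckeGen.a)).map HeckeGen.cst) *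
          (1 - HeckeGen.B •
            (Algebra.leftMulMatrix β (HeckeGen.primeMap HeckeGen.b)).map HeckeGen.cst)) ∧
      HeckeGen.F2 = (1 / 2 : ℂ) •
        (((1 - HeckeGen.A •
            (Algebra.leftMulMatrix β (HeckeGen.primeMap HeckeGen.a)).map HeckeGen.cst) *
          (1 - HeckeGen.B •
            (Algebra.leftMulMatrix β (HeckeGen.primeMap HeckeGen.b)).map HeckeGen.cst))⁻¹).trace) ∧
    -- the second formula, through the explicit matrix
    IsUnit (HeckeGen.matM (HeckeGen.cst HeckeGen.a) (HeckeGen.cst HeckeGen.b)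
      HeckeGen.A HeckeGen.B) ∧
    HeckeGen.F2 = (1 / 2 : ℂ) •
      ((HeckeGen.matM (HeckeGen.cst HeckeGen.a) (HeckeGen.cst HeckeGen.b)
        HeckeGen.A HeckeGen.B)⁻¹).trace ∧
    -- rationality over `ℚ`, with denominator `det M` in lowest terms
    Function.Injective HeckeGen.toSer ∧
    ∃ P : MvPolynomial (Fin 4) ℚ, IsRelPrime P HeckeGen.detM ∧
      HeckeGen.F2 * HeckeGen.toSer HeckeGen.detM = HeckeGen.toSer P := by
  refine ⟨⟨HeckeGen.aeval_injective, HeckeGen.aeval_surjective⟩,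
    ⟨HeckeGen.basisE, HeckeGen.basisE_apply, HeckeGen.leftMulMatrix_e, ?_, ?_⟩,
    HeckeGen.isUnit_matM, HeckeGen.F2_eq_trace_inv, HeckeGen.toSer_injective, _, ?_,
    HeckeGen.F2_mul_toSer_detM⟩
  · rw [← HeckeGen.matM_eq]
    exact HeckeGen.isUnit_matM
  · rw [← HeckeGen.matM_eq]
    exact HeckeGen.F2_eq_trace_inv
  · exact (isRelPrime_mul_unit_left_left
      ((IsUnit.mk0 (1 / 2 : ℚ) (by norm_num)).map MvPolynomial.C)).2
      HeckeGen.isRelPrime_trace_adjugate_detM
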